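/- Let $X$ be a complex Banach space and $T\in L(X)$ a bounded operator with spectrum $\sigma(T)$; write $\mathrm{acc}\,A$ and $\mathrm{iso}\,A$ for the sets of accumulation points and of isolated points of $A\subset\mathbb{C}$. Call $\sigma\subset\sigma(T)$ a spectral set of $T$ if $\sigma$ and $\sigma(T)\setminus\sigma$ are closed, and let $P_\sigma=\frac{1}{2\pi i}\int_\Gamma(\lambda I-T)^{-1}\,d\lambda$ be the associated spectral projection, where $\Gamma$ is any contour surrounding $\sigma$ and separating it from $\sigma(T)\setminus\sigma$. Call $S\in L(X)$ a $g_z$-inverse of $T$ if $S$ is Drazin invertible, $TS=ST$, $STS=S$ and $\mathrm{acc}\,\sigma(T^2S-T)\subset\{0\}$. Suppose that $0\in\sigma(T)\setminus\mathrm{acc}(\mathrm{acc}\,\sigma(T))$, and let $\sigma$ be a spectral set of $T$ with $0\in\sigma$ and $\sigma\setminus\{0\}\subset\mathrm{iso}\,\sigma(T)$. Let $r\in\mathbb{C}$ with $|r|>\max_{\lambda\in\sigma}|\lambda|$. Then $P_\sigma$ is well defined, $T+rP_\sigma$ is invertible, and $$T^D_\sigma:=(T+rP_\sigma)^{-1}(I-P_\sigma)$$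 is a $g_z$-inverse of $T$ (the $g_z$-inverse of $T$ associated to $\sigma$). There are functions $f_\sigma$, holomorphic on an open neighbourhood of $\sigma(T)$, such that $f_\sigma=0$ in a neighbourhood of $\sigma$ and $f_\sigma(\lambda)=\frac1\lambda$ in a neighbourhood of $\sigma(T)\setminus\sigma$, and for every such function $$T^D_\sigma=f_\sigma(T)$$ in the sense of the holomorphic functional calculus, $f_\sigma(T)=\frac{1}{2\pi i}\int_\Gamma f_\sigma(\lambda)(\lambda I-T)^{-1}\,d\lambda$ with $\Gamma$ any contour surrounding $\sigma(T)$ in the domain of $f_\sigma$. Moreover $$\sigma(T^D_\sigma)=\{0\}\cup\{\lambda^{-1}:\lambda\in\sigma(T)\setminus\sigma\}.$$ -/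

import Mathlib

open Set Filter Topology

noncomputable section

/-- A (piecewise `C¹`) `1`-cycle in the plane: finitely many `C¹` curves on `[0, 1]` whose initial
points and terminal points agree as multisets. For example, the consecutive `C¹` pieces of finitely
many closed piecewise `C¹` curves, or the oriented boundary of a bounded domain with piecewise `C¹` boundary. -/
structure PlaneCycle where
  n : ℕ
  path : Fin n → ℝ → ℂ
  contDiffOn : ∀ i, ContDiffOn ℝ 1 (path i) (Icc 0 1)
  closed : (Finset.univ.val.map fun i => path i 0) = Finset.univ.val.map fun i => path i 1

namespace PlaneCycle

/-- The set of points on the curves of the cycle. -/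
def trace (Γ : PlaneCycle) : Set ℂ := ⋃ i, Γ.path i '' Icc 0 1

/-- The contour integral `∫_Γ F(z) dz` of a vector-valued function. -/
def integral {E : Type*} [NormedAddCommGroup E] [NormedSpace ℂ E] (Γ : PlaneCycle) (F : ℂ → E) :
    E :=
  ∑ i, ∫ t in (0 : ℝ)..1, derivWithin (Γ.path i) (Icc 0 1) t • F (Γ.path i t)

/-- The index (winding number) of the cycle around a point off its trace. -/
def index (Γ : PlaneCycle) (a : ℂ) : ℂ :=
  (2 * Real.pi * Complex.I)⁻¹ * Γ.integral fun z => (z - a)⁻¹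

/-- `Γ` surrounds `K` in `U`: it runs in `U \ K`, winds once around every point of `K`, and does
not wind around any point outside `U`. -/
def Surrounds (Γ : PlaneCycle) (K U : Set ℂ) : Prop :=
  Γ.trace ⊆ U \ K ∧ (∀ z ∈ K, Γ.index z = 1) ∧ ∀ z ∉ U, Γ.index z = 0

end PlaneCycle

section Operators

variable {X : Type*} [NormedAddCommGroup X] [NormedSpace ℂ X]

/-- `A` is the value of `(2πi)⁻¹ ∫_Γ f(z) (zI - T)⁻¹ dz` over the contours `Γ` surrounding `K`
in `U`: such contours exist, and each of them gives the value `A`. -/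
def IsRieszIntegral (T : X →L[ℂ] X) (K U : Set ℂ) (f : ℂ → ℂ) (A : X →L[ℂ] X) : Prop :=
  (∃ Γ : PlaneCycle, Γ.Surrounds K U) ∧
    ∀ Γ : PlaneCycle, Γ.Surrounds K U →
      (2 * Real.pi * Complex.I : ℂ)⁻¹ • Γ.integral (fun z => f z • resolvent T z) = A

open Classical in
/-- The common value of `(2πi)⁻¹ ∫_Γ f(z) (zI - T)⁻¹ dz` over all contours `Γ` surrounding `K`
in `U` (and `0` if there is no such value). -/
def rieszIntegral (T : X →L[ℂ] X) (K U : Set ℂ) (f : ℂ → ℂ) : X →L[ℂ] X :=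
  if h : ∃ A, IsRieszIntegral T K U f A then h.choose else 0

/-- The operator `f(T)` of the holomorphic functional calculus, for `f` holomorphic on an open set
`U` containing the spectrum of `T`. -/
def holFunCalc (T : X →L[ℂ] X) (U : Set ℂ) (f : ℂ → ℂ) : X →L[ℂ] X :=
  rieszIntegral T (spectrum ℂ T) U f

/-- `σ` is a spectral set of `T`: a subset of the spectrum such that `σ` and `σ(T) \ σ` are
closed. -/
def IsSpectralSet (T : X →L[ℂ] X) (σ : Set ℂ) : Prop :=
  σ ⊆ spectrum ℂ T ∧ IsClosed σ ∧ IsClosed (spectrum ℂ T \ σ)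

/-- The spectral projection `P_σ = (2πi)⁻¹ ∫_Γ (zI - T)⁻¹ dz` of `T` associated with a spectral
set `σ`; the contour surrounds `σ` and separates it from the rest of the spectrum. -/
def spectralProjection (T : X →L[ℂ] X) (σ : Set ℂ) : X →L[ℂ] X :=
  rieszIntegral T σ (spectrum ℂ T \ σ)ᶜ fun _ => 1

/-- The operator `(T + r P_σ)⁻¹ (I - P_σ)`. -/
def spectralGzInverse (T : X →L[ℂ] X) (σ : Set ℂ) (r : ℂ) : X →L[ℂ] X :=
  Ring.inverse (T + r • spectralProjection T σ) * (1 - spectralProjection T σ)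

/-- The isolated points of a subset of the plane. -/
def isoPoints (A : Set ℂ) : Set ℂ := A \ derivedSet A

/-- `T` is zeroloid: its spectrum has no accumulation point other than `0`. -/
def IsZeroloid (T : X →L[ℂ] X) : Prop := derivedSet (spectrum ℂ T) ⊆ {0}

/-- `T` is Drazin invertible. -/
def IsDrazinInvertible (T : X →L[ℂ] X) : Prop :=
  ∃ S : X →L[ℂ] X, S * T = T * S ∧ S * T * S = S ∧ ∃ n : ℕ, T ^ n * S * T = T ^ n

/-- `S` is a `g_z`-inverse of `T`. -/
def IsGzInverse (T S : X →L[ℂ] X) : Prop :=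
  IsDrazinInvertible S ∧ T * S = S * T ∧ S * T * S = S ∧ IsZeroloid (T ^ 2 * S - T)

/-- `f` is holomorphic on the open neighbourhood `U` of the spectrum of `T`, vanishes near `σ`, and
equals `1 / z` near the rest of the spectrum. -/
def IsReciprocalOff (T : X →L[ℂ] X) (σ U : Set ℂ) (f : ℂ → ℂ) : Prop :=
  IsOpen U ∧ spectrum ℂ T ⊆ U ∧ DifferentiableOn ℂ f U ∧
    (∀ᶠ z in 𝓝ˢ σ, f z = 0) ∧ ∀ᶠ z in 𝓝ˢ (spectrum ℂ T \ σ), f z = 1 / z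

end Operators

end

/-! Everything reduces to scalar identities near the spectrum through the holomorphic functional
calculus. If χ is 1 near σ and 0 near the rest of the spectrum, then P_σ = χ(T). The function z +
rχ(z) has no zero on the spectrum: on σ because |z| < |r|, elsewhere because 0 lies in σ. Since (z +
rχ) f_σ = 1 - χ near the spectrum, T^D_σ = f_σ(T). The algebraic relations of a g_z-inverse are then
pointwise identities, with T(I - P_σ) as Drazin inverse of T^D_σ. The function z² f_σ - z equals -z
on σ and 0 elsewhere, so the spectrum of T²S - T, where S = T^D_σ, lies in -σ, whose only possible
accumulation point is 0. The spectrum of T^D_σ comes from spectral mapping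
(`IsFunCalc.spectrum_eq`).

The calculus itself rests on the homological Cauchy theorem (`integral_eq_of_index_eq`): boundaries
of unions of grid squares surround any compact set (`exists_gridCycle_surrounds`), Cauchy's formula
holds over them, and Fubini turns an integral over an arbitrary cycle into one that depends only on
its winding numbers. Multiplicativity (`IsFunCalc.mul`) follows from the resolvent identity on two
nested cycles, and normalisation (`isFunCalc_one`) from the decay of the resolvent at infinity. -/

noncomputable section

namespace PlaneCycle

variable {E F : Type*} [NormedAddCommGroup E] [NormedSpace ℂ E]
  [NormedAddCommGroup F] [NormedSpace ℂ F]

/-! ### Integration over cycles -/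

section Basic

variable (Γ : PlaneCycle)

theorem path_mem_trace (i : Fin Γ.n) {t : ℝ} (ht : t ∈ Icc (0 : ℝ) 1) : Γ.path i t ∈ Γ.trace :=
  mem_iUnion.2 ⟨i, mem_image_of_mem _ ht⟩

theorem isCompact_trace : IsCompact Γ.trace :=
  isCompact_iUnion fun i => isCompact_Icc.image_of_continuousOn (Γ.contDiffOn i).continuousOn

theorem continuousOn_derivWithin_path (i : Fin Γ.n) :
    ContinuousOn (derivWithin (Γ.path i) (Icc 0 1)) (Icc 0 1) :=
  (Γ.contDiffOn i).continuousOn_derivWithin (uniqueDiffOn_Icc zero_lt_one) le_rfl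

theorem mapsTo_path (i : Fin Γ.n) : MapsTo (Γ.path i) (Icc 0 1) Γ.trace :=
  fun _ ht => Γ.path_mem_trace i ht

variable {Γ}

theorem continuousOn_integrand {f : ℂ → E} (hf : ContinuousOn f Γ.trace) (i : Fin Γ.n) :
    ContinuousOn (fun t => derivWithin (Γ.path i) (Icc 0 1) t • f (Γ.path i t)) (Icc 0 1) :=
  (Γ.continuousOn_derivWithin_path i).smul
    (hf.comp (Γ.contDiffOn i).continuousOn (Γ.mapsTo_path i))

theorem intervalIntegrable_integrand {f : ℂ → E} (hf : ContinuousOn f Γ.trace) (i : Fin Γ.n) :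
    IntervalIntegrable (fun t => derivWithin (Γ.path i) (Icc 0 1) t • f (Γ.path i t))
      MeasureTheory.volume 0 1 :=
  ContinuousOn.intervalIntegrable (by
    rw [uIcc_of_le zero_le_one]; exact continuousOn_integrand hf i)

theorem integral_congr {f g : ℂ → E} (h : EqOn f g Γ.trace) : Γ.integral f = Γ.integral g := by
  refine Finset.sum_congr rfl fun i _ => intervalIntegral.integral_congr fun t ht => ?_
  rw [uIcc_of_le zero_le_one] at ht
  simp only [h (Γ.path_mem_trace i ht)]

theorem integral_add {f g : ℂ → E} (hf : ContinuousOn f Γ.trace) (hg : ContinuousOn g Γ.trace) :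
    Γ.integral (fun z => f z + g z) = Γ.integral f + Γ.integral g := by
  simp only [integral, smul_add, ← Finset.sum_add_distrib]
  exact Finset.sum_congr rfl fun i _ => intervalIntegral.integral_add
    (intervalIntegrable_integrand hf i) (intervalIntegrable_integrand hg i)

theorem integral_sub {f g : ℂ → E} (hf : ContinuousOn f Γ.trace) (hg : ContinuousOn g Γ.trace) :
    Γ.integral (fun z => f z - g z) = Γ.integral f - Γ.integral g := by
  simp only [integral, smul_sub, ← Finset.sum_sub_distrib]
  exact Finset.sum_congr rfl fun i _ => intervalIntegral.integral_sub
    (intervalIntegrable_integrand hf i) (intervalIntegrable_integrand hg i)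

theorem integral_const_smul (c : ℂ) (f : ℂ → E) :
    Γ.integral (fun z => c • f z) = c • Γ.integral f := by
  simp only [integral, Finset.smul_sum]
  refine Finset.sum_congr rfl fun i _ => ?_
  rw [← intervalIntegral.integral_smul]
  simp only [smul_comm c]

theorem integral_clm [CompleteSpace E] [CompleteSpace F] (L : E →L[ℂ] F) {f : ℂ → E}
    (hf : ContinuousOn f Γ.trace) :
    Γ.integral (fun z => L (f z)) = L (Γ.integral f) := by
  simp only [integral, map_sum]
  refine Finset.sum_congr rfl fun i _ => ?_
  rw [← L.intervalIntegral_comp_comm (intervalIntegrable_integrand hf i)]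
  simp only [map_smul]

theorem integral_smul_const [CompleteSpace E] {f : ℂ → ℂ} (hf : ContinuousOn f Γ.trace) (v : E) :
    Γ.integral (fun z => f z • v) = Γ.integral f • v := by
  simpa using integral_clm (Γ := Γ) ((1 : ℂ →L[ℂ] ℂ).smulRight v) hf

/-- The integral of a derivative over a cycle vanishes. -/
theorem integral_eq_zero_of_hasDerivAt [CompleteSpace E] {f g : ℂ → E}
    (hg : ∀ z ∈ Γ.trace, HasDerivAt g (f z) z) (hf : ContinuousOn f Γ.trace) :
    Γ.integral f = 0 := by
  have key : ∀ i, ∫ t in (0 : ℝ)..1, derivWithin (Γ.path i) (Icc 0 1) t • f (Γ.path i t) =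
      g (Γ.path i 1) - g (Γ.path i 0) := fun i => by
    refine intervalIntegral.integral_eq_sub_of_hasDerivAt_of_le (f := fun t => g (Γ.path i t))
      zero_le_one ?_ (fun t ht => ?_) (intervalIntegrable_integrand hf i)
    · have : ContinuousOn g Γ.trace := fun z hz => (hg z hz).continuousAt.continuousWithinAt
      exact this.comp (Γ.contDiffOn i).continuousOn (Γ.mapsTo_path i)
    · have hd : HasDerivAt (Γ.path i) (derivWithin (Γ.path i) (Icc 0 1) t) t :=
        (((Γ.contDiffOn i).differentiableOn one_ne_zero) t
          (Ioo_subset_Icc_self ht)).hasDerivWithinAt.hasDerivAt (Icc_mem_nhds ht.1 ht.2)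
      exact (hg _ (Γ.path_mem_trace i (Ioo_subset_Icc_self ht))).scomp t hd
  have h := congrArg (fun s : Multiset ℂ => (s.map g).sum) Γ.closed
  simp only [Multiset.map_map] at h
  simp only [integral, key, Finset.sum_sub_distrib]
  exact sub_eq_zero.2 h.symm

theorem integrable_integrand_prod {Γ' : PlaneCycle} {f : ℂ → ℂ → E}
    (hf : ContinuousOn (fun p : ℂ × ℂ => f p.1 p.2) (Γ.trace ×ˢ Γ'.trace))
    (i : Fin Γ.n) (j : Fin Γ'.n) :
    MeasureTheory.Integrable (Function.uncurry fun t s : ℝ =>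
      derivWithin (Γ.path i) (Icc 0 1) t • derivWithin (Γ'.path j) (Icc 0 1) s •
        f (Γ.path i t) (Γ'.path j s))
      ((MeasureTheory.volume.restrict (Ioc 0 1)).prod
        (MeasureTheory.volume.restrict (Ioc 0 1))) := by
  rw [MeasureTheory.Measure.prod_restrict]
  refine MeasureTheory.IntegrableOn.mono_set (t := Icc 0 1 ×ˢ Icc 0 1) ?_
    (prod_mono Ioc_subset_Icc_self Ioc_subset_Icc_self)
  refine ContinuousOn.integrableOn_compact (isCompact_Icc.prod isCompact_Icc) ?_
  refine ((Γ.continuousOn_derivWithin_path i).comp continuousOn_fst fun p hp => hp.1).smul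
    (((Γ'.continuousOn_derivWithin_path j).comp continuousOn_snd fun p hp => hp.2).smul ?_)
  refine hf.comp (f := fun p : ℝ × ℝ => (Γ.path i p.1, Γ'.path j p.2)) ?_ ?_
  · exact ((Γ.contDiffOn i).continuousOn.comp continuousOn_fst fun p hp => hp.1).prodMk
      ((Γ'.contDiffOn j).continuousOn.comp continuousOn_snd fun p hp => hp.2)
  · exact fun p hp => ⟨Γ.path_mem_trace i hp.1, Γ'.path_mem_trace j hp.2⟩

theorem integral_integral_eq_sum {Γ' : PlaneCycle} {f : ℂ → ℂ → E}
    (hf : ContinuousOn (fun p : ℂ × ℂ => f p.1 p.2) (Γ.trace ×ˢ Γ'.trace)) :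
    Γ.integral (fun z => Γ'.integral fun w => f z w) = ∑ i, ∑ j, ∫ t in (0 : ℝ)..1,
      ∫ s in (0 : ℝ)..1, derivWithin (Γ.path i) (Icc 0 1) t •
      derivWithin (Γ'.path j) (Icc 0 1) s • f (Γ.path i t) (Γ'.path j s) := by
  refine Finset.sum_congr rfl fun i _ => ?_
  rw [← intervalIntegral.integral_finsetSum]
  · refine intervalIntegral.integral_congr fun t _ => ?_
    simp only [integral, Finset.smul_sum, intervalIntegral.integral_smul]
  · intro j _
    rw [intervalIntegrable_iff, uIoc_of_le zero_le_one]
    simp only [intervalIntegral.integral_of_le (zero_le_one' ℝ)]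
    exact (integrable_integrand_prod hf i j).integral_prod_left

/-- Interchanging two contour integrals. -/
theorem integral_integral_swap {Γ' : PlaneCycle} {f : ℂ → ℂ → E}
    (hf : ContinuousOn (fun p : ℂ × ℂ => f p.1 p.2) (Γ.trace ×ˢ Γ'.trace)) :
    Γ.integral (fun z => Γ'.integral fun w => f z w) =
      Γ'.integral fun w => Γ.integral fun z => f z w := by
  have hf' : ContinuousOn (fun p : ℂ × ℂ => f p.2 p.1) (Γ'.trace ×ˢ Γ.trace) :=
    hf.comp continuous_swap.continuousOn fun p hp => ⟨hp.2, hp.1⟩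
  rw [integral_integral_eq_sum hf, integral_integral_eq_sum (f := fun w z => f z w) hf',
    Finset.sum_comm]
  refine Finset.sum_congr rfl fun j _ => Finset.sum_congr rfl fun i _ => ?_
  simp only [intervalIntegral.integral_of_le (zero_le_one' ℝ)]
  rw [MeasureTheory.integral_integral_swap (integrable_integrand_prod hf i j)]
  simp only [smul_comm (derivWithin (Γ.path i) (Icc 0 1) _)]

end Basic

/-! ### Winding numbers -/

section Index

variable {Γ : PlaneCycle}

theorem continuousOn_sub_inv {s : Set ℂ} {a : ℂ} (ha : a ∉ s) :
    ContinuousOn (fun z => (z - a)⁻¹) s :=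
  (continuousOn_id.sub continuousOn_const).inv₀ fun z hz h =>
    ha (sub_eq_zero.1 (show z - a = 0 from h) ▸ hz)

theorem integral_sub_inv (Γ : PlaneCycle) (a : ℂ) :
    Γ.integral (fun z => (z - a)⁻¹) = (2 * Real.pi * Complex.I) * Γ.index a := by
  rw [index, mul_inv_cancel_left₀ Complex.two_pi_I_ne_zero]

/-- The index is locally constant off the trace. -/
theorem index_eq_of_norm_sub_lt {a b : ℂ} (h : ∀ z ∈ Γ.trace, ‖b - a‖ < ‖z - a‖) :
    Γ.index b = Γ.index a := by
  have ha : a ∉ Γ.trace := fun hz => by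
    have := h a hz; simp only [sub_self, norm_zero] at this; exact (norm_nonneg _).not_gt this
  have hb : b ∉ Γ.trace := fun hz => lt_irrefl _ (h b hz)
  have key : Γ.integral (fun z => (z - b)⁻¹ - (z - a)⁻¹) = 0 := by
    -- The quotient stays within distance less than 1 of the point 1, so the principal logarithm is
    -- a primitive along the whole trace.
    refine integral_eq_zero_of_hasDerivAt (g := fun z => Complex.log ((z - b) / (z - a))) ?_
      ((continuousOn_sub_inv hb).sub (continuousOn_sub_inv ha))
    intro z hz
    have hza : z - a ≠ 0 := fun h0 => ha (sub_eq_zero.1 h0 ▸ hz)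
    have hzb : z - b ≠ 0 := fun h0 => hb (sub_eq_zero.1 h0 ▸ hz)
    have hs : (z - b) / (z - a) ∈ Complex.slitPlane := by
      have : (z - b) / (z - a) = 1 + (-((b - a) / (z - a))) := by field_simp; ring
      rw [this]
      refine Complex.mem_slitPlane_of_norm_lt_one ?_
      rw [norm_neg, norm_div, div_lt_one (norm_pos_iff.2 hza)]
      exact h z hz
    have hd := (((hasDerivAt_id z).sub_const b).div ((hasDerivAt_id z).sub_const a) hza).clog hs
    refine hd.congr_deriv ?_
    simp only [id, Pi.div_apply]
    field_simp
  rw [integral_sub (continuousOn_sub_inv hb) (continuousOn_sub_inv ha)] at key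
  rw [index, index, sub_eq_zero.1 key]

theorem index_eventuallyEq {a : ℂ} (ha : a ∉ Γ.trace) : ∀ᶠ b in 𝓝 a, Γ.index b = Γ.index a := by
  obtain ⟨ε, hε, h⟩ := Metric.isOpen_iff.1 Γ.isCompact_trace.isClosed.isOpen_compl a ha
  filter_upwards [Metric.ball_mem_nhds a hε] with b hb
  refine index_eq_of_norm_sub_lt fun z hz => ?_
  rw [Metric.mem_ball, dist_eq_norm] at hb
  refine hb.trans_le (not_lt.1 fun hlt => h (show z ∈ Metric.ball a ε from ?_) hz)
  rwa [Metric.mem_ball, dist_eq_norm]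

/-- On the disc of radius `‖a‖` the principal branch of log(1 - z/a) is a primitive of the
integrand. This makes the set of nonzero index bounded. -/
theorem index_eq_zero_of_norm_lt {a : ℂ} (h : ∀ z ∈ Γ.trace, ‖z‖ < ‖a‖) : Γ.index a = 0 := by
  have ha : a ∉ Γ.trace := fun hz => lt_irrefl _ (h a hz)
  rw [index, integral_eq_zero_of_hasDerivAt (g := fun z => Complex.log (1 + -(z / a))) ?_
    (continuousOn_sub_inv ha), mul_zero]
  intro z hz
  have ha0 : a ≠ 0 := norm_pos_iff.1 ((norm_nonneg z).trans_lt (h z hz))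
  have hza : z - a ≠ 0 := fun h0 => ha (sub_eq_zero.1 h0 ▸ hz)
  have hs : 1 + -(z / a) ∈ Complex.slitPlane := by
    refine Complex.mem_slitPlane_of_norm_lt_one ?_
    rw [norm_neg, norm_div, div_lt_one (norm_pos_iff.2 ha0)]
    exact h z hz
  have hd := ((((hasDerivAt_id z).div_const a).fun_neg).const_add 1).clog hs
  refine hd.congr_deriv ?_
  have h2 : 1 + -(z / a) ≠ 0 := Complex.slitPlane_ne_zero hs
  have h3 : a - z ≠ 0 := fun h0 => hza (by linear_combination -h0)
  have h4 : 1 + -(z / a) = (a - z) / a := by field_simp; ring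
  simp only [id, h4]
  rw [inv_eq_one_div, div_div_eq_mul_div, neg_mul, div_mul_cancel₀ _ ha0, div_eq_div_iff h3 hza]
  ring

end Index

/-! ### Cycles from finite families, and sums of cycles -/

section Construct

/-- The cycle given by a finite family of curves. -/
def ofFintype {ι : Type*} [Fintype ι] (p : ι → ℝ → ℂ) (hp : ∀ i, ContDiffOn ℝ 1 (p i) (Icc 0 1))
    (hc : (Finset.univ.val.map fun i => p i 0) = Finset.univ.val.map fun i => p i 1) :
    PlaneCycle where
  n := Fintype.card ι
  path k := p ((Fintype.equivFin ι).symm k)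
  contDiffOn k := hp _
  closed := by
    have h : ∀ g : ι → ℂ, (Finset.univ.val.map fun k => g ((Fintype.equivFin ι).symm k)) =
        Finset.univ.val.map g := fun g => by
      rw [← Finset.map_univ_equiv (Fintype.equivFin ι).symm, Finset.map_val, Multiset.map_map]
      rfl
    rw [h fun i => p i 0, h fun i => p i 1, hc]

variable {ι : Type*} [Fintype ι] {p : ι → ℝ → ℂ} {hp : ∀ i, ContDiffOn ℝ 1 (p i) (Icc 0 1)}
    {hc : (Finset.univ.val.map fun i => p i 0) = Finset.univ.val.map fun i => p i 1}

theorem trace_ofFintype : (ofFintype p hp hc).trace = ⋃ i, p i '' Icc 0 1 :=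
  (Fintype.equivFin ι).symm.surjective.iUnion_comp fun i => p i '' Icc 0 1

theorem integral_ofFintype (f : ℂ → E) : (ofFintype p hp hc).integral f =
    ∑ i, ∫ t in (0 : ℝ)..1, derivWithin (p i) (Icc 0 1) t • f (p i t) :=
  (Fintype.equivFin ι).symm.sum_comp fun i =>
    ∫ t in (0 : ℝ)..1, derivWithin (p i) (Icc 0 1) t • f (p i t)

/-- The sum of two cycles. -/
def append (Γ Γ' : PlaneCycle) : PlaneCycle :=
  ofFintype (Sum.elim Γ.path Γ'.path) (by rintro (i | i); exacts [Γ.contDiffOn i, Γ'.contDiffOn i])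
    (by
      have h : ∀ g : Fin Γ.n ⊕ Fin Γ'.n → ℂ, Finset.univ.val.map g =
          (Finset.univ.val.map fun i => g (Sum.inl i)) +
            Finset.univ.val.map fun i => g (Sum.inr i) := fun g => by
        rw [← Finset.univ_disjSum_univ, Finset.val_disjSum, Multiset.disjSum, Multiset.map_add,
          Multiset.map_map, Multiset.map_map]
        rfl
      rw [h, h]
      simp only [Sum.elim_inl, Sum.elim_inr]
      rw [Γ.closed, Γ'.closed])

theorem trace_append (Γ Γ' : PlaneCycle) : (Γ.append Γ').trace = Γ.trace ∪ Γ'.trace := by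
  rw [append, trace_ofFintype, iUnion_sum]
  rfl

theorem integral_append (Γ Γ' : PlaneCycle) (f : ℂ → E) :
    (Γ.append Γ').integral f = Γ.integral f + Γ'.integral f := by
  rw [append, integral_ofFintype, Fintype.sum_sum_type]
  rfl

theorem index_append (Γ Γ' : PlaneCycle) (a : ℂ) :
    (Γ.append Γ').index a = Γ.index a + Γ'.index a := by
  rw [index, integral_append, mul_add, index, index]

end Construct
end PlaneCycle

namespace PlaneCycle

variable {E : Type*} [NormedAddCommGroup E] [NormedSpace ℂ E]

/-! ### Boundaries of unions of grid squares -/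

section Grid

/-- The `d`-th power of `I`: the four outer normals of a square. -/
def normal (d : Fin 4) : ℂ := Complex.I ^ (d : ℕ)

theorem normal_add_one (d : Fin 4) : normal (d + 1) = Complex.I * normal d := by
  fin_cases d <;> simp [normal, pow_succ]

theorem normal_add_two (d : Fin 4) : normal (d + 2) = -normal d := by
  rw [show d + 2 = d + 1 + 1 by rw [add_assoc]; rfl, normal_add_one, normal_add_one, ← mul_assoc,
    Complex.I_mul_I, neg_one_mul]

theorem normal_ne_zero (d : Fin 4) : normal d ≠ 0 := pow_ne_zero _ Complex.I_ne_zero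

/-- The edge with outer normal `normal d` of the square with centre `c` and side `2 * h`,
positively oriented. -/
def edge (h : ℝ) (p : ℂ × Fin 4) (t : ℝ) : ℂ :=
  p.1 + h * normal p.2 * (1 + Complex.I * (2 * t - 1))

/-- The same edge, seen from the adjacent square. -/
def reverse (h : ℝ) (p : ℂ × Fin 4) : ℂ × Fin 4 := (p.1 + 2 * h * normal p.2, p.2 + 2)

variable {h : ℝ}

theorem edge_reverse (p : ℂ × Fin 4) (t : ℝ) : edge h (reverse h p) t = edge h p (1 - t) := by
  simp only [edge, reverse, normal_add_two]
  push_cast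
  ring

theorem reverse_reverse (p : ℂ × Fin 4) : reverse h (reverse h p) = p := by
  refine Prod.ext ?_ ?_
  · simp only [reverse, normal_add_two]; ring
  · simp only [reverse, add_assoc]
    exact add_zero _

theorem edge_one (c : ℂ) (d : Fin 4) : edge h (c, d) 1 = edge h (c, d + 1) 0 := by
  simp only [edge, normal_add_one]
  push_cast
  linear_combination ((h : ℂ) * normal d) * Complex.I_mul_I

theorem hasDerivAt_edge (p : ℂ × Fin 4) (t : ℝ) :
    HasDerivAt (edge h p) (h * normal p.2 * (Complex.I * 2)) t := by
  have h1 : HasDerivAt (fun t : ℝ => (t : ℂ)) 1 t := Complex.ofRealCLM.hasDerivAt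
  have h2 := ((((h1.const_mul 2).sub_const 1).const_mul Complex.I).const_add 1).const_mul
    ((h : ℂ) * normal p.2) |>.const_add p.1
  exact h2.congr_deriv (by rw [mul_one])

theorem contDiff_edge (p : ℂ × Fin 4) : ContDiff ℝ 1 (edge h p) := by
  have : ContDiff ℝ 1 (fun t : ℝ => (t : ℂ)) := Complex.ofRealCLM.contDiff
  unfold edge
  fun_prop

/-- The integral along an edge. -/
def edgeIntegral (h : ℝ) (p : ℂ × Fin 4) (f : ℂ → E) : E :=
  ∫ t in (0 : ℝ)..1, (h * normal p.2 * (Complex.I * 2)) • f (edge h p t)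

theorem edgeIntegral_eq (p : ℂ × Fin 4) (f : ℂ → E) :
    ∫ t in (0 : ℝ)..1, derivWithin (edge h p) (Icc 0 1) t • f (edge h p t) =
      edgeIntegral h p f := by
  refine intervalIntegral.integral_congr fun t ht => ?_
  rw [uIcc_of_le zero_le_one] at ht
  simp only [(hasDerivAt_edge p t).hasDerivWithinAt.derivWithin (uniqueDiffOn_Icc zero_lt_one t ht)]

theorem edgeIntegral_reverse (p : ℂ × Fin 4) (f : ℂ → E) :
    edgeIntegral h (reverse h p) f = -edgeIntegral h p f := by
  have := intervalIntegral.integral_comp_sub_left (a := 0) (b := 1)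
    (fun t => (h * normal p.2 * (Complex.I * 2)) • f (edge h p t)) 1
  simp only [sub_zero, sub_self] at this
  rw [edgeIntegral, edgeIntegral, ← this, ← intervalIntegral.integral_neg]
  refine intervalIntegral.integral_congr fun t _ => ?_
  simp only [edge_reverse]
  simp only [reverse, normal_add_two, mul_neg, neg_mul, neg_smul]

open Classical in
/-- The edges of squares with centres in `S` whose adjacent square is not in the family. -/
def boundaryEdges (h : ℝ) (S : Finset ℂ) : Finset (ℂ × Fin 4) :=
  {p ∈ S ×ˢ Finset.univ | (reverse h p).1 ∉ S}

open Classical in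
/-- The edges shared by two squares with centres in `S`. -/
def innerEdges (h : ℝ) (S : Finset ℂ) : Finset (ℂ × Fin 4) :=
  {p ∈ S ×ˢ Finset.univ | ¬ (reverse h p).1 ∉ S}

variable {M : Type*} [AddCommMonoid M]

theorem sum_boundaryEdges_add_sum_innerEdges (S : Finset ℂ) (g : ℂ × Fin 4 → M) :
    ∑ p ∈ boundaryEdges h S, g p + ∑ p ∈ innerEdges h S, g p = ∑ c ∈ S, ∑ d, g (c, d) := by
  rw [boundaryEdges, innerEdges, Finset.sum_filter_add_sum_filter_not, Finset.sum_product]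

theorem sum_innerEdges_reverse (S : Finset ℂ) (g : ℂ × Fin 4 → M) :
    ∑ p ∈ innerEdges h S, g (reverse h p) = ∑ p ∈ innerEdges h S, g p := by
  have key : ∀ p ∈ innerEdges h S, reverse h p ∈ innerEdges h S := fun p hp => by
    simp only [innerEdges, Finset.mem_filter, Finset.mem_product, Finset.mem_univ, and_true,
      not_not, reverse_reverse] at hp ⊢
    exact hp.symm
  exact Finset.sum_nbij' (reverse h) (reverse h) key key (fun p _ => reverse_reverse p)
    (fun p _ => reverse_reverse p) fun _ _ => rfl

/-- Each square is a closed circuit, so over all edges starts and ends agree. Reversal permutes the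
inner edges and exchanges their endpoints, so these contribute equally to both sides and cancel. -/
theorem sum_singleton_boundaryEdges (S : Finset ℂ) :
    ∑ p ∈ boundaryEdges h S, ({edge h p 0} : Multiset ℂ) =
      ∑ p ∈ boundaryEdges h S, {edge h p 1} := by
  have h1 := sum_innerEdges_reverse (h := h) S fun p => ({edge h p 0} : Multiset ℂ)
  simp only [edge_reverse, sub_zero] at h1
  refine add_right_cancel (b := ∑ p ∈ innerEdges h S, ({edge h p 1} : Multiset ℂ)) ?_
  rw [sum_boundaryEdges_add_sum_innerEdges, h1, sum_boundaryEdges_add_sum_innerEdges]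
  refine Finset.sum_congr rfl fun c _ => ?_
  simp only [edge_one]
  exact (Equiv.sum_comp (Equiv.addRight (1 : Fin 4))
    fun d => ({edge h (c, d) 0} : Multiset ℂ)).symm

/-- The oriented boundary of a finite union of squares of side `2 * h` with centres in `S`. -/
def gridCycle (h : ℝ) (S : Finset ℂ) : PlaneCycle :=
  ofFintype (fun p : boundaryEdges h S => edge h p) (fun p => (contDiff_edge _).contDiffOn) (by
    have key : ∀ g : ℂ × Fin 4 → ℂ, (Finset.univ.val.map fun p : boundaryEdges h S => g p) =
        ∑ p ∈ boundaryEdges h S, {g p} := fun g => by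
      rw [← Finset.sum_coe_sort, ← Multiset.sum_map_singleton (Multiset.map _ _), Multiset.map_map]
      rfl
    rw [key fun p => edge h p 0, key fun p => edge h p 1, sum_singleton_boundaryEdges])

/-- An inner edge is traversed once in each direction, so the inner sum equals its own negative.
Integrals thereby split over single squares. -/
theorem integral_gridCycle (S : Finset ℂ) (f : ℂ → E) :
    (gridCycle h S).integral f = ∑ c ∈ S, ∑ d, edgeIntegral h (c, d) f := by
  have h0 : ∑ p ∈ innerEdges h S, edgeIntegral h p f = 0 := by
    have h1 := sum_innerEdges_reverse (h := h) S fun p => edgeIntegral h p f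
    simp only [edgeIntegral_reverse, Finset.sum_neg_distrib] at h1
    have h2 : (2 : ℂ) • ∑ p ∈ innerEdges h S, edgeIntegral h p f = 0 := by
      rw [two_smul]
      nth_rewrite 1 [← h1]
      exact neg_add_cancel _
    exact (smul_eq_zero.1 h2).resolve_left two_ne_zero
  rw [← sum_boundaryEdges_add_sum_innerEdges (h := h) S fun p => edgeIntegral h p f, h0, add_zero, gridCycle, integral_ofFintype]
  simp only [edgeIntegral_eq]
  exact Finset.sum_coe_sort (boundaryEdges h S) fun p => edgeIntegral h p f

theorem integral_gridCycle_eq_sum (S : Finset ℂ) (f : ℂ → E) :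
    (gridCycle h S).integral f = ∑ c ∈ S, (gridCycle h {c}).integral f := by
  simp only [integral_gridCycle, Finset.sum_singleton]

theorem index_gridCycle_eq_sum (S : Finset ℂ) (z : ℂ) :
    (gridCycle h S).index z = ∑ c ∈ S, (gridCycle h {c}).index z := by
  rw [index, integral_gridCycle_eq_sum, Finset.mul_sum]
  rfl

theorem mem_trace_gridCycle {S : Finset ℂ} {z : ℂ} (hz : z ∈ (gridCycle h S).trace) :
    ∃ p : ℂ × Fin 4, p.1 ∈ S ∧ (reverse h p).1 ∉ S ∧ ∃ t ∈ Icc (0 : ℝ) 1, z = edge h p t := by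
  rw [gridCycle, trace_ofFintype] at hz
  obtain ⟨⟨p, hp⟩, t, ht, rfl⟩ := mem_iUnion.1 hz
  simp only [boundaryEdges, Finset.mem_filter, Finset.mem_product, Finset.mem_univ, and_true] at hp
  exact ⟨p, hp.1, hp.2, t, ht, rfl⟩

/-- The closed square with centre `c` and side `2 * h`. -/
def square (h : ℝ) (c : ℂ) : Set ℂ := {z | |(z - c).re| ≤ h ∧ |(z - c).im| ≤ h}

theorem edge_mem_square (hh : 0 ≤ h) (p : ℂ × Fin 4) {t : ℝ} (ht : t ∈ Icc (0 : ℝ) 1) :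
    edge h p t ∈ square h p.1 := by
  obtain ⟨c, d⟩ := p
  have h1 : |h| * |2 * t - 1| ≤ h := by
    rw [abs_of_nonneg hh]
    exact mul_le_of_le_one_right hh (abs_le.2 ⟨by linarith [ht.1], by linarith [ht.2]⟩)
  have h2 : |h| ≤ h := (abs_of_nonneg hh).le
  fin_cases d <;> simp [square, edge, normal, pow_succ, h1, h2, abs_neg]

theorem trace_gridCycle_subset (hh : 0 ≤ h) (c : ℂ) : (gridCycle h {c}).trace ⊆ square h c := by
  intro z hz
  obtain ⟨p, hp, -, t, ht, rfl⟩ := mem_trace_gridCycle hz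
  rw [← Finset.mem_singleton.1 hp]
  exact edge_mem_square hh p ht

theorem norm_sub_le_of_mem_square {c z : ℂ} (hz : z ∈ square h c) : ‖z - c‖ ≤ 2 * h :=
  (Complex.norm_le_abs_re_add_abs_im _).trans (by linarith [hz.1, hz.2])

/-- Cauchy's theorem for a square. -/
theorem integral_gridCycle_singleton_eq_zero [CompleteSpace E] (hh : 0 < h) {c : ℂ} {f : ℂ → E}
    (hf : DifferentiableOn ℂ f (Metric.ball c (3 * h))) : (gridCycle h {c}).integral f = 0 := by
  -- The square lies within `2 * h` of its centre; an open disc around it suffices because there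
  -- holomorphic functions have primitives.
  have hsub : (gridCycle h {c}).trace ⊆ Metric.ball c (3 * h) := fun z hz => by
    rw [Metric.mem_ball, dist_eq_norm]
    linarith [norm_sub_le_of_mem_square (trace_gridCycle_subset hh.le c hz)]
  obtain ⟨g, hg⟩ := hf.isExactOn_ball
  exact integral_eq_zero_of_hasDerivAt (fun z hz => hg z (hsub hz)) (hf.continuousOn.mono hsub)

/-- The cycle lies in an open half-plane bounded by a line through `z`; after rotation by `k` the
principal logarithm is a primitive. -/
theorem index_eq_zero_of_re_pos {Γ : PlaneCycle} {z k : ℂ}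
    (hk : ∀ w ∈ Γ.trace, 0 < ((w - z) * k).re) : Γ.index z = 0 := by
  have hz : z ∉ Γ.trace := fun hz => by simpa using hk z hz
  rw [index, integral_eq_zero_of_hasDerivAt (g := fun w => Complex.log ((w - z) * k)) ?_
    (continuousOn_sub_inv hz), mul_zero]
  intro w hw
  have h0 : (w - z) * k ≠ 0 := fun h0 => by simpa [h0] using hk w hw
  refine ((((hasDerivAt_id w).sub_const z).mul_const k).clog (Or.inl (hk w hw))).congr_deriv ?_
  simp only [id, one_mul]
  field_simp [left_ne_zero_of_mul h0, right_ne_zero_of_mul h0]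

theorem index_gridCycle_singleton_of_notMem (hh : 0 ≤ h) {c z : ℂ} (hz : z ∉ square h c) :
    (gridCycle h {c}).index z = 0 := by
  have hsub := trace_gridCycle_subset hh c
  simp only [square, mem_ofPred_eq, not_and_or, not_le, lt_abs, Complex.sub_re, Complex.sub_im] at hz
  have hw : ∀ w ∈ (gridCycle h {c}).trace, (-h ≤ w.re - c.re ∧ w.re - c.re ≤ h) ∧
      (-h ≤ w.im - c.im ∧ w.im - c.im ≤ h) := fun w hw => by
    simpa only [square, mem_ofPred_eq, abs_le, Complex.sub_re, Complex.sub_im] using hsub hw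
  rcases hz with (hz | hz) | (hz | hz)
  · exact index_eq_zero_of_re_pos (k := -1) fun w h' => by simp; linarith [hw w h']
  · exact index_eq_zero_of_re_pos (k := 1) fun w h' => by simp; linarith [hw w h']
  · exact index_eq_zero_of_re_pos (k := Complex.I) fun w h' => by simp; linarith [hw w h']
  · exact index_eq_zero_of_re_pos (k := -Complex.I) fun w h' => by simp; linarith [hw w h']

/-- For `b` in the open fourth quadrant a quarter turn does not cross the branch cut. -/
theorem log_I_mul {b : ℂ} (hre : 0 < b.re) (him : b.im < 0) :
    Complex.log (Complex.I * b) = Complex.log b + Real.pi / 2 * Complex.I := by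
  have h0 : b ≠ 0 := fun h0 => by simp [h0] at hre
  have h1 : Complex.arg b < 0 := Complex.arg_neg_iff.2 him
  have h2 := Complex.neg_pi_lt_arg b
  have := Real.pi_pos
  rw [Complex.log_mul Complex.I_ne_zero h0 (by rw [Complex.arg_I]; constructor <;> linarith),
    Complex.log_I, add_comm]

/-- Seen from `z` and divided by its outer normal, each edge lies in the right half-plane, where the
principal logarithm is a primitive. Passing from one edge to the next changes the branch by πi/2;
the logarithms telescope around the square and four quarter turns give 2πi. -/
theorem index_gridCycle_singleton_of_abs_lt {c z : ℂ} (hre : |(z - c).re| < h)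
    (him : |(z - c).im| < h) : (gridCycle h {c}).index z = 1 := by
  have hh : 0 < h := (abs_nonneg _).trans_lt hre
  have hn : ∀ d, |((z - c) / normal d).re| < h ∧ |((z - c) / normal d).im| < h := fun d => by
    rw [Complex.sub_re, abs_sub_comm] at hre
    rw [Complex.sub_im, abs_sub_comm] at him
    fin_cases d <;> simp [normal, pow_succ, div_neg, hre, him, abs_sub_comm]
  have hsplit : ∀ d (t : ℝ), (edge h (c, d) t - z) / normal d =
      h * (1 + Complex.I * (2 * t - 1)) - (z - c) / normal d := fun d t => by
    have := normal_ne_zero d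
    simp only [edge]
    field_simp
    ring
  have hpos : ∀ d (t : ℝ), 0 < ((edge h (c, d) t - z) / normal d).re := fun d t => by
    rw [hsplit]
    have := (abs_lt.1 (hn d).1).2
    simp only [Complex.sub_re, Complex.mul_re, Complex.add_re, Complex.add_im]
    simp
    simpa using this
  have hneg : ∀ d, ((edge h (c, d) 0 - z) / normal d).im < 0 := fun d => by
    rw [hsplit]
    have := (abs_lt.1 (hn d).2).1
    simp only [Complex.sub_im, Complex.mul_im, Complex.add_re, Complex.add_im]
    simp
    linarith
  have hedge : ∀ d, edgeIntegral h (c, d) (fun w => (w - z)⁻¹) =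
      Complex.log ((edge h (c, d + 1) 0 - z) / normal (d + 1)) + Real.pi / 2 * Complex.I -
        Complex.log ((edge h (c, d) 0 - z) / normal d) := fun d => by
    have h1 := log_I_mul (hpos (d + 1) 0) (hneg (d + 1))
    rw [← h1, ← edge_one]
    have h2 : Complex.I * ((edge h (c, d) 1 - z) / normal (d + 1)) =
        (edge h (c, d) 1 - z) / normal d := by
      rw [normal_add_one, mul_div_assoc', mul_div_mul_left _ _ Complex.I_ne_zero]
    rw [h2]
    refine intervalIntegral.integral_eq_sub_of_hasDerivAt
      (f := fun t => Complex.log ((edge h (c, d) t - z) / normal d)) (fun t _ => ?_) ?_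
    · have hd := (((hasDerivAt_edge (h := h) (c, d) t).sub_const z).div_const (normal d)).clog_real
        (Or.inl (hpos d t))
      refine hd.congr_deriv ?_
      have hne : edge h (c, d) t - z ≠ 0 := fun h0 => by simpa [h0] using hpos d t
      have := normal_ne_zero d
      simp only [smul_eq_mul]
      field_simp
    · refine Continuous.intervalIntegrable ?_ _ _
      have : Continuous fun t => (edge h (c, d) t - z)⁻¹ :=
        ((contDiff_edge _).continuous.sub continuous_const).inv₀
          fun t h0 => by
            have h1 := hpos d t
            rw [show edge h (c, d) t - z = 0 from h0, zero_div] at h1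
            exact lt_irrefl _ h1
      exact this.const_smul (h * normal d * (Complex.I * 2) : ℂ)
  rw [index, integral_gridCycle, Finset.sum_singleton]
  simp only [hedge, Finset.sum_sub_distrib, Finset.sum_add_distrib]
  -- The cyclic shift of the four edges makes the sum telescope.
  rw [show ∑ d : Fin 4, Complex.log ((edge h (c, d + 1) 0 - z) / normal (d + 1)) =
    ∑ d, Complex.log ((edge h (c, d) 0 - z) / normal d) from
    Equiv.sum_comp (Equiv.addRight (1 : Fin 4))
      fun d => Complex.log ((edge h (c, d) 0 - z) / normal d), add_sub_cancel_left,
    Finset.sum_const, Finset.card_univ, Fintype.card_fin]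
  have := Complex.two_pi_I_ne_zero
  rw [inv_mul_eq_one₀ this, nsmul_eq_mul]
  push_cast
  ring

/-- The centres of the squares of the grid of mesh `2 * h`. -/
def gridPoint (h : ℝ) (m n : ℤ) : ℂ := 2 * h * (m + n * Complex.I)

theorem gridPoint_re (m n : ℤ) : (gridPoint h m n).re = 2 * h * m := by simp [gridPoint]

theorem gridPoint_im (m n : ℤ) : (gridPoint h m n).im = 2 * h * n := by simp [gridPoint]

theorem exists_gridPoint_add (m n : ℤ) (d : Fin 4) :
    ∃ m' n', gridPoint h m n + 2 * h * normal d = gridPoint h m' n' := by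
  fin_cases d
  · exact ⟨m + 1, n, by simp [gridPoint, normal]; ring⟩
  · exact ⟨m, n + 1, by simp [gridPoint, normal]; ring⟩
  · exact ⟨m - 1, n, by simp [gridPoint, normal]; ring⟩
  · exact ⟨m, n - 1, by simp [gridPoint, normal, pow_succ]; ring⟩

theorem exists_mem_square (hh : 0 < h) (z : ℂ) : ∃ m n, z ∈ square h (gridPoint h m n) := by
  have key : ∀ x : ℝ, |x - 2 * h * round (x / (2 * h))| ≤ h := fun x => by
    have h1 := abs_sub_round (x / (2 * h))
    have h2 : x - 2 * h * round (x / (2 * h)) = 2 * h * (x / (2 * h) - round (x / (2 * h))) := by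
      field_simp
    rw [h2, abs_mul, abs_of_pos (by linarith : 0 < 2 * h)]
    nlinarith
  refine ⟨round (z.re / (2 * h)), round (z.im / (2 * h)), ?_⟩
  simp only [square, mem_ofPred_eq, Complex.sub_re, Complex.sub_im, gridPoint_re, gridPoint_im]
  exact ⟨key _, key _⟩

/-- Coordinates of centres are multiples of `2 * h`, and here they differ by less than `2 * h`. -/
theorem gridPoint_eq_of_mem_square (hh : 0 < h) {z : ℂ} {m n m' n' : ℤ}
    (hre : |(z - gridPoint h m n).re| < h) (him : |(z - gridPoint h m n).im| < h)
    (hz : z ∈ square h (gridPoint h m' n')) : m' = m ∧ n' = n := by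
  have key : ∀ {x : ℝ} {k l : ℤ}, |x - 2 * h * k| < h → |x - 2 * h * l| ≤ h → l = k := by
    intro x k l h1 h2
    have h3 : |(2 * h) * ((l : ℝ) - k)| < 2 * h * 1 := by
      rw [abs_lt] at h1 ⊢
      rw [abs_le] at h2
      constructor <;> linarith [h1.1, h1.2, h2.1, h2.2]
    rw [abs_mul, abs_of_pos (by linarith : 0 < 2 * h)] at h3
    have h4 : |((l - k : ℤ) : ℝ)| < 1 := by
      push_cast
      exact lt_of_mul_lt_mul_left h3 (by linarith)
    have h5 : |l - k| < 1 := by exact_mod_cast h4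
    exact sub_eq_zero.1 (Int.abs_lt_one_iff.1 h5)
  simp only [square, mem_ofPred_eq, Complex.sub_re, Complex.sub_im, gridPoint_re,
    gridPoint_im] at hre him hz
  exact ⟨key hre hz.1, key him hz.2⟩

/-- The centres of the squares of the grid that meet `K`. -/
def gridCentres (h : ℝ) (K : Set ℂ) : Set ℂ :=
  {c | (∃ m n, c = gridPoint h m n) ∧ (square h c ∩ K).Nonempty}

theorem finite_gridCentres (hh : 0 < h) {K : Set ℂ} (hK : Bornology.IsBounded K) :
    (gridCentres h K).Finite := by
  obtain ⟨R, hR⟩ := hK.exists_norm_le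
  set N : ℤ := ⌈(R + h) / (2 * h)⌉
  refine ((finite_Icc (-N) N).prod (finite_Icc (-N) N)).image
    (fun q : ℤ × ℤ => gridPoint h q.1 q.2) |>.subset ?_
  rintro _ ⟨⟨m, n, rfl⟩, z, hz, hzK⟩
  have key : ∀ {x : ℝ} {k : ℤ}, |x| ≤ R → |x - 2 * h * k| ≤ h → k ∈ Icc (-N) N := by
    intro x k h1 h2
    have h3 : |(2 * h) * (k : ℝ)| ≤ R + h := by
      rw [abs_le] at *
      constructor <;> linarith [h1.1, h1.2, h2.1, h2.2]
    rw [abs_mul, abs_of_pos (by linarith : 0 < 2 * h), mul_comm,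
      ← le_div_iff₀ (by linarith : 0 < 2 * h)] at h3
    have h4 : ((|k| : ℤ) : ℝ) ≤ N := by
      push_cast
      exact h3.trans (Int.le_ceil _)
    exact abs_le.1 (by exact_mod_cast h4)
  simp only [square, mem_ofPred_eq, Complex.sub_re, Complex.sub_im, gridPoint_re,
    gridPoint_im] at hz
  exact ⟨(m, n), ⟨key ((Complex.abs_re_le_norm z).trans (hR z hzK)) hz.1,
    key ((Complex.abs_im_le_norm z).trans (hR z hzK)) hz.2⟩, rfl⟩

/-- A compact set is surrounded, in any of its open neighbourhoods, by the boundary of a union of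
small squares. -/
theorem exists_gridCycle_surrounds {K U : Set ℂ} (hK : IsCompact K) (hU : IsOpen U) (hKU : K ⊆ U) :
    ∃ (h : ℝ) (S : Finset ℂ), 0 < h ∧ (∀ c ∈ S, Metric.ball c (3 * h) ⊆ U) ∧
      (gridCycle h S).Surrounds K U := by
  obtain ⟨δ, hδ, hthick⟩ := hK.exists_thickening_subset_open hU hKU
  -- A point within `3 * h` of a selected centre is within `3 * h + 2 * h < δ` of `K`.
  obtain ⟨h, hh, hhδ⟩ : ∃ h : ℝ, 0 < h ∧ 6 * h = δ := ⟨δ / 6, by positivity, by ring⟩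
  have hfin := finite_gridCentres hh hK.isBounded
  set S := hfin.toFinset
  have hS : ∀ c, c ∈ S ↔ c ∈ gridCentres h K := fun c => hfin.mem_toFinset
  have hball : ∀ c ∈ S, Metric.ball c (3 * h) ⊆ U := fun c hc w hw => by
    obtain ⟨-, k, hk, hkK⟩ := (hS c).1 hc
    refine hthick (Metric.mem_thickening_iff.2 ⟨k, hkK, ?_⟩)
    have h1 := norm_sub_le_of_mem_square hk
    rw [← dist_eq_norm, dist_comm] at h1
    have := dist_triangle w c k
    rw [Metric.mem_ball] at hw
    linarith
  -- If a boundary edge met `K`, the square across it would meet `K` too and would have been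
  -- selected.
  have htrace : (gridCycle h S).trace ⊆ U \ K := by
    intro z hz
    obtain ⟨p, hp, hp', t, ht, rfl⟩ := mem_trace_gridCycle hz
    refine ⟨hball _ hp ?_, fun hzK => hp' ?_⟩
    · rw [Metric.mem_ball, dist_eq_norm]
      linarith [norm_sub_le_of_mem_square (edge_mem_square hh.le p ht)]
    · obtain ⟨⟨m, n, hmn⟩, -⟩ := (hS _).1 hp
      refine (hS _).2 ⟨?_, edge h p t, ?_, hzK⟩
      · simp only [reverse, hmn]
        exact exists_gridPoint_add m n p.2
      · have := edge_mem_square hh.le (reverse h p) (t := 1 - t)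
          ⟨by linarith [ht.2], by linarith [ht.1]⟩
        rwa [edge_reverse, sub_sub_cancel] at this
  refine ⟨h, S, hh, hball, htrace, fun z hz => ?_, fun z hz => ?_⟩
  · obtain ⟨m, n, hmn⟩ := exists_mem_square hh z
    have hcS : gridPoint h m n ∈ S := (hS _).2 ⟨⟨m, n, rfl⟩, z, hmn, hz⟩
    -- The point `z` may lie on an edge between squares. A small move towards the centre of a square
    -- containing it keeps the index and reaches the interior of that square, outside all the
    -- others.
    have hev := index_eventuallyEq fun hz' => (htrace hz').2 hz
    have hlim : Tendsto (fun ε : ℝ => z + ε * (gridPoint h m n - z)) (𝓝[>] 0) (𝓝 z) := by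
      refine tendsto_nhdsWithin_of_tendsto_nhds ?_
      have : Continuous fun ε : ℝ => z + ε * (gridPoint h m n - z) := by fun_prop
      simpa using this.tendsto 0
    obtain ⟨ε, hε, hε0, hε1⟩ := ((hlim.eventually hev).and
      (Ioo_mem_nhdsGT (zero_lt_one' ℝ))).exists
    have hsmall : ∀ x : ℝ, |x| ≤ h → |(1 - ε) * x| < h := fun x hx => by
      rw [abs_mul, abs_of_pos (by linarith)]
      nlinarith [abs_nonneg x]
    have hw : z + ε * (gridPoint h m n - z) - gridPoint h m n =
        ((1 - ε : ℝ) : ℂ) * (z - gridPoint h m n) := by push_cast; ring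
    have hre : |(z + ε * (gridPoint h m n - z) - gridPoint h m n).re| < h := by
      rw [hw, Complex.re_ofReal_mul]; exact hsmall _ hmn.1
    have him : |(z + ε * (gridPoint h m n - z) - gridPoint h m n).im| < h := by
      rw [hw, Complex.im_ofReal_mul]; exact hsmall _ hmn.2
    rw [← hε, index_gridCycle_eq_sum, Finset.sum_eq_single_of_mem _ hcS,
      index_gridCycle_singleton_of_abs_lt hre him]
    intro c hc hne
    refine index_gridCycle_singleton_of_notMem hh.le fun hmem => hne ?_
    obtain ⟨⟨m', n', rfl⟩, -⟩ := (hS c).1 hc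
    obtain ⟨rfl, rfl⟩ := gridPoint_eq_of_mem_square hh hre him hmem
    rfl
  · rw [index_gridCycle_eq_sum]
    refine Finset.sum_eq_zero fun c hc => ?_
    rw [index, integral_gridCycle_singleton_eq_zero hh, mul_zero]
    refine DifferentiableOn.inv (by fun_prop) fun w hw h0 => hz ?_
    rw [← sub_eq_zero.1 h0]
    exact hball c hc hw
end Grid
end PlaneCycle

namespace PlaneCycle

variable {E : Type*} [NormedAddCommGroup E] [NormedSpace ℂ E] [CompleteSpace E]

/-! ### Homological Cauchy theorem and integral formula -/

section Cauchy

/-- The cycle without curves. -/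
def empty : PlaneCycle where
  n := 0
  path := fun i => i.elim0
  contDiffOn := fun i => i.elim0
  closed := rfl

theorem integral_empty {E : Type*} [NormedAddCommGroup E] [NormedSpace ℂ E] (f : ℂ → E) : empty.integral f = 0 := rfl

theorem trace_empty : empty.trace = ∅ :=
  iUnion_eq_empty.2 fun i : Fin 0 => i.elim0

theorem index_empty (z : ℂ) : empty.index z = 0 := mul_zero _

theorem Surrounds.mono {Γ : PlaneCycle} {K U V : Set ℂ} (h : Γ.Surrounds K U) (hUV : U ⊆ V) :
    Γ.Surrounds K V :=
  ⟨h.1.trans (sdiff_subset_sdiff_left hUV), h.2.1, fun z hz => h.2.2 z fun hzU => hz (hUV hzU)⟩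

theorem exists_surrounds {K U : Set ℂ} (hK : IsCompact K) (hU : IsOpen U) (hKU : K ⊆ U) :
    ∃ Γ : PlaneCycle, Γ.Surrounds K U :=
  let ⟨h, S, _, _, hΓ⟩ := exists_gridCycle_surrounds hK hU hKU
  ⟨gridCycle h S, hΓ⟩

/-- Cauchy's integral formula, for a cycle over which the integrals of holomorphic functions
vanish. -/
theorem cauchy_formula_of_integral_eq_zero {Γ : PlaneCycle} {U : Set ℂ} (hU : IsOpen U)
    (hΓ : Γ.trace ⊆ U) (h0 : ∀ g : ℂ → E, DifferentiableOn ℂ g U → Γ.integral g = 0)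
    {f : ℂ → E} (hf : DifferentiableOn ℂ f U) {z : ℂ} (hz : z ∈ U) (hzΓ : z ∉ Γ.trace) :
    Γ.integral (fun w => (w - z)⁻¹ • f w) = (2 * Real.pi * Complex.I * Γ.index z) • f z := by
  -- The difference quotient of `f` at `z` extends holomorphically across `z`, so its integral
  -- vanishes.
  have hd := h0 _ ((Complex.differentiableOn_dslope (hU.mem_nhds hz)).2 hf)
  have hc := continuousOn_sub_inv hzΓ
  rw [integral_congr (g := fun w => (w - z)⁻¹ • f w - (w - z)⁻¹ • f z),
    integral_sub (f := fun w => (w - z)⁻¹ • f w) (g := fun w => (w - z)⁻¹ • f z)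
    (hc.smul (hf.continuousOn.mono hΓ)) (hc.smul continuousOn_const), integral_smul_const hc,
    integral_sub_inv, sub_eq_zero] at hd
  · exact hd
  · intro w hw
    simp only [dslope_of_ne _ (show w ≠ z from fun h => hzΓ (h ▸ hw)), slope_def_module, smul_sub]

/-- Closed because indices are locally constant off the traces, bounded because both vanish far out.
-/
theorem isCompact_trace_union_index_ne (Γ₁ Γ₂ : PlaneCycle) :
    IsCompact (Γ₁.trace ∪ Γ₂.trace ∪ {z | Γ₁.index z ≠ Γ₂.index z}) := by
  set K : Set ℂ := Γ₁.trace ∪ Γ₂.trace ∪ {z | Γ₁.index z ≠ Γ₂.index z} with hKdef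
  have hKc : IsClosed K := by
    rw [← isOpen_compl_iff, isOpen_iff_mem_nhds]
    intro z hz
    simp only [hKdef, mem_compl_iff, mem_union, not_or, mem_ofPred_eq, not_not] at hz
    filter_upwards [index_eventuallyEq hz.1.1, index_eventuallyEq hz.1.2,
      Γ₁.isCompact_trace.isClosed.isOpen_compl.mem_nhds hz.1.1,
      Γ₂.isCompact_trace.isClosed.isOpen_compl.mem_nhds hz.1.2] with w e1 e2 w1 w2
    simp only [hKdef, mem_compl_iff, mem_union, not_or, mem_ofPred_eq, not_not]
    exact ⟨⟨w1, w2⟩, by rw [e1, e2, hz.2]⟩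
  have hKb : Bornology.IsBounded K := by
    obtain ⟨R, hR⟩ := (Γ₁.isCompact_trace.union Γ₂.isCompact_trace).isBounded.exists_norm_le
    refine isBounded_iff_forall_norm_le.2 ⟨R, fun z hz => ?_⟩
    rcases hz with hz | hz
    · exact hR z hz
    · by_contra! hlt
      refine hz ?_
      rw [index_eq_zero_of_norm_lt fun w hw => (hR w (Or.inl hw)).trans_lt hlt,
        index_eq_zero_of_norm_lt fun w hw => (hR w (Or.inr hw)).trans_lt hlt]
  exact Metric.isCompact_of_isClosed_isBounded hKc hKb

/-- The homological form of Cauchy's theorem. -/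
theorem integral_eq_of_index_eq {Γ₁ Γ₂ : PlaneCycle} {U : Set ℂ} (hU : IsOpen U)
    (h₁ : Γ₁.trace ⊆ U) (h₂ : Γ₂.trace ⊆ U) (hind : ∀ z ∉ U, Γ₁.index z = Γ₂.index z)
    {f : ℂ → E} (hf : DifferentiableOn ℂ f U) : Γ₁.integral f = Γ₂.integral f := by
  set K : Set ℂ := Γ₁.trace ∪ Γ₂.trace ∪ {z | Γ₁.index z ≠ Γ₂.index z} 
  have hKU : K ⊆ U := union_subset (union_subset h₁ h₂) fun z hz => by
    by_contra hzU
    exact hz (hind z hzU)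
  obtain ⟨h, S, hh, hball, hΓ⟩ :=
    exists_gridCycle_surrounds (isCompact_trace_union_index_ne Γ₁ Γ₂) hU hKU
  set Γ := gridCycle h S
  have h0 : ∀ g : ℂ → E, DifferentiableOn ℂ g U → Γ.integral g = 0 := fun g hg => by
    rw [integral_gridCycle_eq_sum]
    exact Finset.sum_eq_zero fun c hc =>
      integral_gridCycle_singleton_eq_zero hh (hg.mono (hball c hc))
  -- The grid cycle reproduces `f` on `K` by Cauchy's formula, as holomorphic functions integrate to
  -- zero over each of its squares.
  have hform : ∀ z ∈ K, f z = (2 * Real.pi * Complex.I : ℂ)⁻¹ •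
      Γ.integral (fun w => (w - z)⁻¹ • f w) := fun z hz => by
    rw [cauchy_formula_of_integral_eq_zero hU (hΓ.1.trans sdiff_subset) h0 hf (hKU hz)
      fun h => (hΓ.1 h).2 hz, hΓ.2.1 z hz, mul_one, inv_smul_smul₀ Complex.two_pi_I_ne_zero]
  -- Fubini: after the swap, the inner integral of the Cauchy kernel over `Γ'` is a winding number,
  -- so only the indices of `Γ'` on the trace of `Γ` matter. These agree for `Γ₁` and `Γ₂`, since
  -- that trace avoids `K`.
  have key : ∀ Γ' : PlaneCycle, Γ'.trace ⊆ K → Γ'.integral f = (2 * Real.pi * Complex.I : ℂ)⁻¹ •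
      Γ.integral (fun w => -(2 * Real.pi * Complex.I * Γ'.index w) • f w) := fun Γ' hΓ' => by
    rw [integral_congr fun z hz => hform z (hΓ' hz), integral_const_smul, integral_integral_swap]
    · congr 1
      refine integral_congr fun w hw => ?_
      have hc : ContinuousOn (fun z => (z - w)⁻¹) Γ'.trace :=
        continuousOn_sub_inv fun hwΓ' => (hΓ.1 hw).2 (hΓ' hwΓ')
      have hflip : (fun z => (w - z)⁻¹ • f w) = fun z => (-1 : ℂ) • ((z - w)⁻¹ • f w) := by
        funext z
        rw [neg_one_smul, ← neg_smul, ← inv_neg, neg_sub]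
      simp only [hflip]
      rw [integral_const_smul, integral_smul_const hc, integral_sub_inv, neg_one_smul, neg_smul]
    · refine ContinuousOn.smul (ContinuousOn.inv₀ (by fun_prop) ?_) ?_
      · rintro ⟨z, w⟩ ⟨hz, hw⟩ h0
        exact (hΓ.1 hw).2 (sub_eq_zero.1 h0 ▸ hΓ' hz)
      · exact (hf.continuousOn.mono (hΓ.1.trans sdiff_subset)).comp continuousOn_snd
          fun p hp => hp.2
  rw [key Γ₁ (subset_union_left.trans subset_union_left),
    key Γ₂ (subset_union_right.trans subset_union_left)]
  congr 1
  refine integral_congr fun w hw => ?_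
  have : Γ₁.index w = Γ₂.index w := by
    by_contra hne
    exact (hΓ.1 hw).2 (Or.inr hne)
  simp only [this]

theorem integral_eq_zero_of_index_eq_zero {Γ : PlaneCycle} {U : Set ℂ} (hU : IsOpen U)
    (hΓ : Γ.trace ⊆ U) (hind : ∀ z ∉ U, Γ.index z = 0) {f : ℂ → E}
    (hf : DifferentiableOn ℂ f U) : Γ.integral f = 0 := by
  rw [← integral_empty f]
  refine integral_eq_of_index_eq hU hΓ ?_ (fun z hz => ?_) hf
  · rw [trace_empty]
    exact empty_subset _
  · rw [hind z hz, index_empty]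

theorem Surrounds.integral_eq {Γ₁ Γ₂ : PlaneCycle} {K U : Set ℂ} (h₁ : Γ₁.Surrounds K U)
    (h₂ : Γ₂.Surrounds K U) (hK : IsClosed K) (hU : IsOpen U) {f : ℂ → E}
    (hf : DifferentiableOn ℂ f (U \ K)) : Γ₁.integral f = Γ₂.integral f := by
  refine integral_eq_of_index_eq (hU.sdiff hK) h₁.1 h₂.1 (fun z hz => ?_) hf
  by_cases hzK : z ∈ K
  · rw [h₁.2.1 z hzK, h₂.2.1 z hzK]
  · have hzU : z ∉ U := fun hzU => hz ⟨hzU, hzK⟩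
    rw [h₁.2.2 z hzU, h₂.2.2 z hzU]

theorem Surrounds.integral_eq_zero {Γ : PlaneCycle} {K U : Set ℂ} (h : Γ.Surrounds K U)
    (hU : IsOpen U) {f : ℂ → E} (hf : DifferentiableOn ℂ f U) : Γ.integral f = 0 :=
  integral_eq_zero_of_index_eq_zero hU (h.1.trans sdiff_subset) h.2.2 hf

/-- The homological form of Cauchy's integral formula. -/
theorem Surrounds.cauchy_formula {Γ : PlaneCycle} {K U : Set ℂ} (h : Γ.Surrounds K U)
    (hU : IsOpen U) {f : ℂ → E} (hf : DifferentiableOn ℂ f U) {z : ℂ} (hzU : z ∈ U) (hz : z ∈ K) :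
    Γ.integral (fun w => (w - z)⁻¹ • f w) = (2 * Real.pi * Complex.I : ℂ) • f z := by
  rw [cauchy_formula_of_integral_eq_zero hU (h.1.trans sdiff_subset)
    (fun g hg => h.integral_eq_zero hU hg) hf hzU fun hzΓ => (h.1 hzΓ).2 hz, h.2.1 z hz, mul_one]

/-- Outside a given cycle there is another one, which surrounds the given cycle. -/
theorem Surrounds.exists_outer {Γ : PlaneCycle} {K U : Set ℂ} (h : Γ.Surrounds K U)
    (hK : IsCompact K) (hU : IsOpen U) (hKU : K ⊆ U) :
    ∃ Γ' : PlaneCycle, Γ'.Surrounds K U ∧ Γ'.Surrounds Γ.trace U ∧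
      ∀ w ∈ Γ'.trace, Γ.index w = 0 := by
  have hL := isCompact_trace_union_index_ne Γ empty
  simp only [trace_empty, union_empty, index_empty] at hL
  have hLU : Γ.trace ∪ {z | Γ.index z ≠ 0} ⊆ U := union_subset (h.1.trans sdiff_subset) fun z hz => by
    by_contra hzU
    exact hz (h.2.2 z hzU)
  -- Surrounding also the points of nonzero index forces `Γ` not to wind around points of the new
  -- trace.
  obtain ⟨Γ', hΓ'⟩ := exists_surrounds (hK.union hL) hU (union_subset hKU hLU)
  refine ⟨Γ', ⟨hΓ'.1.trans (sdiff_subset_sdiff_right subset_union_left),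
    fun z hz => hΓ'.2.1 z (Or.inl hz), hΓ'.2.2⟩,
    ⟨hΓ'.1.trans (sdiff_subset_sdiff_right (subset_union_left.trans subset_union_right)),
    fun z hz => hΓ'.2.1 z (Or.inr (Or.inl hz)), hΓ'.2.2⟩, fun w hw => ?_⟩
  by_contra hne
  exact (hΓ'.1 hw).2 (Or.inr (Or.inr hne))

end Cauchy
end PlaneCycle

/-! ### Holomorphic functional calculus -/

section FunctionalCalculus

open PlaneCycle

variable {X : Type*} [NormedAddCommGroup X] [NormedSpace ℂ X] [CompleteSpace X] {T : X →L[ℂ] X}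

theorem PlaneCycle.integral_mul_const {A : Type*} [NormedRing A] [NormedAlgebra ℂ A]
    [CompleteSpace A] {Γ : PlaneCycle} {f : ℂ → A} (hf : ContinuousOn f Γ.trace) (b : A) :
    Γ.integral (fun z => f z * b) = Γ.integral f * b :=
  integral_clm ((ContinuousLinearMap.mul ℂ A).flip b) hf

theorem PlaneCycle.integral_const_mul {A : Type*} [NormedRing A] [NormedAlgebra ℂ A]
    [CompleteSpace A] {Γ : PlaneCycle} {f : ℂ → A} (hf : ContinuousOn f Γ.trace) (a : A) :
    Γ.integral (fun z => a * f z) = a * Γ.integral f :=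
  integral_clm (ContinuousLinearMap.mul ℂ A a) hf

theorem differentiableOn_resolvent (T : X →L[ℂ] X) :
    DifferentiableOn ℂ (resolvent T) (spectrum ℂ T)ᶜ := fun _ hz =>
  (spectrum.hasDerivAt_resolvent_const_left (spectrum.notMem_iff.1 hz)).differentiableAt.differentiableWithinAt

theorem sub_mul_resolvent {z : ℂ} (hz : z ∉ spectrum ℂ T) :
    (algebraMap ℂ _ z - T) * resolvent T z = 1 :=
  Ring.mul_inverse_cancel _ (spectrum.notMem_iff.1 hz)

theorem mul_resolvent {z : ℂ} (hz : z ∉ spectrum ℂ T) :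
    T * resolvent T z = z • resolvent T z - 1 := by
  rw [← sub_mul_resolvent hz, sub_mul, Algebra.algebraMap_eq_smul_one, smul_mul_assoc, one_mul,
    sub_sub_cancel]

theorem resolvent_mul_resolvent {z w : ℂ} (hz : z ∉ spectrum ℂ T) (hw : w ∉ spectrum ℂ T)
    (hzw : w ≠ z) :
    resolvent T z * resolvent T w = (w - z)⁻¹ • (resolvent T z - resolvent T w) := by
  have h : resolvent T z - resolvent T w = (w - z) • (resolvent T z * resolvent T w) := by
    rw [resolvent, resolvent, Ring.inverse_sub_inverse
      (iff_of_true (spectrum.notMem_iff.1 hz) (spectrum.notMem_iff.1 hw)), sub_sub_sub_cancel_right,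
      ← map_sub, ← Algebra.commutes, mul_assoc, ← Algebra.smul_def]
  rw [h, inv_smul_smul₀ (sub_ne_zero.2 hzw)]

theorem isRieszIntegral_of_surrounds {K U : Set ℂ} (hK : IsClosed K) (hU : IsOpen U)
    (hsp : U ∩ spectrum ℂ T ⊆ K) {f : ℂ → ℂ} (hf : DifferentiableOn ℂ f U) {Γ : PlaneCycle}
    (hΓ : Γ.Surrounds K U) :
    IsRieszIntegral T K U f
      ((2 * Real.pi * Complex.I : ℂ)⁻¹ • Γ.integral fun z => f z • resolvent T z) := by
  refine ⟨⟨Γ, hΓ⟩, fun Γ' hΓ' => ?_⟩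
  rw [hΓ'.integral_eq hΓ hK hU]
  exact (hf.mono sdiff_subset).smul
    ((differentiableOn_resolvent T).mono fun z hz hzs => hz.2 (hsp ⟨hz.1, hzs⟩))

theorem isRieszIntegral_rieszIntegral {K U : Set ℂ} (hK : IsCompact K) (hU : IsOpen U)
    (hKU : K ⊆ U) (hsp : U ∩ spectrum ℂ T ⊆ K) {f : ℂ → ℂ} (hf : DifferentiableOn ℂ f U) :
    IsRieszIntegral T K U f (rieszIntegral T K U f) := by
  obtain ⟨Γ, hΓ⟩ := exists_surrounds hK hU hKU
  have h : ∃ A, IsRieszIntegral T K U f A :=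
    ⟨_, isRieszIntegral_of_surrounds hK.isClosed hU hsp hf hΓ⟩
  rw [rieszIntegral, dif_pos h]
  exact h.choose_spec

/-- `A` is the value `f(T)` of the holomorphic functional calculus, for a function `f` that is
holomorphic on some open neighbourhood of the spectrum of `T`. -/
def IsFunCalc (T : X →L[ℂ] X) (f : ℂ → ℂ) (A : X →L[ℂ] X) : Prop :=
  ∃ U, IsOpen U ∧ spectrum ℂ T ⊆ U ∧ DifferentiableOn ℂ f U ∧
    IsRieszIntegral T (spectrum ℂ T) U f A

theorem isRieszIntegral_holFunCalc {U : Set ℂ} (hU : IsOpen U) (hTU : spectrum ℂ T ⊆ U)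
    {f : ℂ → ℂ} (hf : DifferentiableOn ℂ f U) :
    IsRieszIntegral T (spectrum ℂ T) U f (holFunCalc T U f) :=
  isRieszIntegral_rieszIntegral (spectrum.isCompact T) hU hTU inter_subset_right hf

theorem isFunCalc_holFunCalc {U : Set ℂ} (hU : IsOpen U) (hTU : spectrum ℂ T ⊆ U)
    {f : ℂ → ℂ} (hf : DifferentiableOn ℂ f U) : IsFunCalc T f (holFunCalc T U f) :=
  ⟨U, hU, hTU, hf, isRieszIntegral_holFunCalc hU hTU hf⟩

theorem isFunCalc_of_surrounds {U : Set ℂ} (hU : IsOpen U) (hTU : spectrum ℂ T ⊆ U)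
    {f : ℂ → ℂ} (hf : DifferentiableOn ℂ f U) {Γ : PlaneCycle}
    (hΓ : Γ.Surrounds (spectrum ℂ T) U) {A : X →L[ℂ] X}
    (hA : (2 * Real.pi * Complex.I : ℂ)⁻¹ • Γ.integral (fun z => f z • resolvent T z) = A) :
    IsFunCalc T f A :=
  ⟨U, hU, hTU, hf, hA ▸ isRieszIntegral_of_surrounds (spectrum.isClosed T) hU inter_subset_right
    hf hΓ⟩

theorem PlaneCycle.Surrounds.continuousOn_resolvent {Γ : PlaneCycle} {U : Set ℂ}
    (h : Γ.Surrounds (spectrum ℂ T) U) : ContinuousOn (resolvent T) Γ.trace :=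
  (differentiableOn_resolvent T).continuousOn.mono fun _ hz => (h.1 hz).2

namespace IsFunCalc

variable {f g : ℂ → ℂ} {A B : X →L[ℂ] X}

/-- One cycle inside both domains and the region of agreement computes both operators. Operator
identities thus reduce to pointwise identities near the spectrum. -/
theorem unique (hA : IsFunCalc T f A) (hB : IsFunCalc T g B)
    (hfg : ∀ᶠ z in 𝓝ˢ (spectrum ℂ T), f z = g z) : A = B := by
  obtain ⟨U, hU, hTU, -, -, hUA⟩ := hA
  obtain ⟨V, hV, hTV, -, -, hVB⟩ := hB
  obtain ⟨W, hW, hTW, hWfg⟩ := eventually_nhdsSet_iff_exists.1 hfg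
  obtain ⟨Γ, hΓ⟩ := exists_surrounds (spectrum.isCompact T) ((hU.inter hV).inter hW)
    (subset_inter (subset_inter hTU hTV) hTW)
  rw [← hUA Γ (hΓ.mono (inter_subset_left.trans inter_subset_left)),
    ← hVB Γ (hΓ.mono (inter_subset_left.trans inter_subset_right))]
  congr 1
  refine integral_congr fun z hz => ?_
  simp only [hWfg z (hΓ.1 hz).1.2]

/-- Two values of the functional calculus are given by integrals over common cycles. -/
theorem exists_common (hA : IsFunCalc T f A) (hB : IsFunCalc T g B) :
    ∃ U, IsOpen U ∧ spectrum ℂ T ⊆ U ∧ DifferentiableOn ℂ f U ∧ DifferentiableOn ℂ g U ∧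
      ∀ Γ : PlaneCycle, Γ.Surrounds (spectrum ℂ T) U →
        Γ.integral (fun z => f z • resolvent T z) = (2 * Real.pi * Complex.I : ℂ) • A ∧
        Γ.integral (fun z => g z • resolvent T z) = (2 * Real.pi * Complex.I : ℂ) • B := by
  obtain ⟨U, hU, hTU, hfU, -, hUA⟩ := hA
  obtain ⟨V, hV, hTV, hgV, -, hVB⟩ := hB
  refine ⟨U ∩ V, hU.inter hV, subset_inter hTU hTV, hfU.mono inter_subset_left,
    hgV.mono inter_subset_right, fun Γ hΓ => ?_⟩
  rw [← hUA Γ (hΓ.mono inter_subset_left), ← hVB Γ (hΓ.mono inter_subset_right)]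
  simp only [smul_inv_smul₀ Complex.two_pi_I_ne_zero, and_self]

theorem linearComb (hA : IsFunCalc T f A) (hB : IsFunCalc T g B) (a b : ℂ) :
    IsFunCalc T (fun z => a * f z + b * g z) (a • A + b • B) := by
  obtain ⟨U, hU, hTU, hf, hg, h⟩ := hA.exists_common hB
  obtain ⟨Γ, hΓ⟩ := exists_surrounds (spectrum.isCompact T) hU hTU
  refine isFunCalc_of_surrounds (f := fun z => a * f z + b * g z) hU hTU
    ((hf.const_mul a).add (hg.const_mul b)) hΓ ?_
  have hR := hΓ.continuousOn_resolvent
  have hf' := (hf.continuousOn.mono (hΓ.1.trans sdiff_subset)).smul hR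
  have hg' := (hg.continuousOn.mono (hΓ.1.trans sdiff_subset)).smul hR
  simp only [add_smul, mul_smul]
  rw [integral_add (f := fun z => a • f z • resolvent T z) (g := fun z => b • g z • resolvent T z)
    (hf'.const_smul a) (hg'.const_smul b), integral_const_smul, integral_const_smul, (h Γ hΓ).1,
    (h Γ hΓ).2, smul_comm a, smul_comm b, ← smul_add, inv_smul_smul₀ Complex.two_pi_I_ne_zero]

/-- The resolvent identity splits the integrand, and Cauchy's formula for `g` on the outer cycle
evaluates the part with `resolvent T z`. -/
theorem integral_resolvent_div {U : Set ℂ} (hU : IsOpen U) {Γ Γ' : PlaneCycle}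
    (hΓ : Γ.Surrounds (spectrum ℂ T) U) (hΓ' : Γ'.Surrounds (spectrum ℂ T) U)
    (hΓΓ' : Γ'.Surrounds Γ.trace U) {g : ℂ → ℂ} (hg : DifferentiableOn ℂ g U) {z : ℂ}
    (hz : z ∈ Γ.trace) :
    Γ'.integral (fun w => (w - z)⁻¹ • g w • resolvent T w) =
      ((2 * Real.pi * Complex.I : ℂ) • g z) • resolvent T z -
        resolvent T z * Γ'.integral fun w => g w • resolvent T w := by
  have hR' := hΓ'.continuousOn_resolvent
  have hgc' := hg.continuousOn.mono (hΓ'.1.trans sdiff_subset)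
  have hne : ∀ w ∈ Γ'.trace, w ≠ z := fun w hw hwz => (hΓΓ'.1 hw).2 (hwz ▸ hz)
  have hinv : ContinuousOn (fun w => (w - z)⁻¹) Γ'.trace :=
    continuousOn_sub_inv fun hz' => hne z hz' rfl
  have e : ∀ w ∈ Γ'.trace, (w - z)⁻¹ • g w • resolvent T w =
      ((w - z)⁻¹ • g w) • resolvent T z - resolvent T z * (g w • resolvent T w) := by
    intro w hw
    rw [mul_smul_comm, resolvent_mul_resolvent (hΓ.1 hz).2 (hΓ'.1 hw).2 (hne w hw),
      smul_eq_mul, mul_comm, mul_smul, ← smul_sub, ← smul_sub, sub_sub_cancel, smul_comm]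
  have h2 : Γ'.integral (fun w => resolvent T z * (g w • resolvent T w)) =
      resolvent T z * Γ'.integral fun w => g w • resolvent T w :=
    integral_const_mul (f := fun w => g w • resolvent T w) (hgc'.smul hR') (resolvent T z)
  rw [integral_congr e,
    integral_sub (f := fun w => ((w - z)⁻¹ • g w) • resolvent T z)
      (g := fun w => resolvent T z * (g w • resolvent T w))
      ((hinv.smul hgc').smul continuousOn_const) (continuousOn_const.mul (hgc'.smul hR')),
    PlaneCycle.integral_smul_const (f := fun w => (w - z)⁻¹ • g w) (hinv.smul hgc'),
    hΓΓ'.cauchy_formula hU hg ((hΓ.1 hz).1) hz, h2]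

/-- After the swap, the integrand in `z` is holomorphic on `U` minus the point `w`, around which the
inner cycle does not wind. -/
theorem integral_integral_div_eq_zero {E : Type*} [NormedAddCommGroup E] [NormedSpace ℂ E]
    [CompleteSpace E] {K U : Set ℂ} (hU : IsOpen U) {Γ Γ' : PlaneCycle}
    (hΓ : Γ.Surrounds K U) (hΓΓ' : Γ'.Surrounds Γ.trace U) (hind : ∀ w ∈ Γ'.trace, Γ.index w = 0)
    {f : ℂ → ℂ} (hf : DifferentiableOn ℂ f U) {G : ℂ → E} (hG : ContinuousOn G Γ'.trace) :
    Γ.integral (fun z => Γ'.integral fun w => (f z * (w - z)⁻¹) • G w) = 0 := by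
  have hne : ∀ z ∈ Γ.trace, ∀ w ∈ Γ'.trace, w ≠ z := fun z hz w hw hwz =>
    (hΓΓ'.1 hw).2 (hwz ▸ hz)
  have hfc := hf.continuousOn.mono (hΓ.1.trans sdiff_subset)
  rw [integral_integral_swap]
  · rw [integral_congr (g := fun _ => 0) fun w hw => ?_]
    · simp [PlaneCycle.integral]
    have hwΓ : w ∉ Γ.trace := fun hw' => hne w hw' w hw rfl
    have hd : DifferentiableOn ℂ (fun z => f z * (w - z)⁻¹) (U \ {w}) :=
      (hf.mono sdiff_subset).mul (DifferentiableOn.inv (by fun_prop)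
        fun z hz h0 => hz.2 (sub_eq_zero.1 h0).symm)
    have hsub : Γ.trace ⊆ U \ {w} := fun z hz => ⟨(hΓ.1 hz).1, fun hzw => hwΓ (hzw ▸ hz)⟩
    simp only
    rw [PlaneCycle.integral_smul_const (hd.continuousOn.mono hsub),
      integral_eq_zero_of_index_eq_zero (hU.sdiff isClosed_singleton) hsub ?_ hd, zero_smul]
    intro z hz
    by_cases hzw : z = w
    · rw [hzw, hind w hw]
    · exact hΓ.2.2 z fun hzU => hz ⟨hzU, hzw⟩
  · have h1 : ContinuousOn (fun p : ℂ × ℂ => (p.2 - p.1)⁻¹) (Γ.trace ×ˢ Γ'.trace) :=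
      ContinuousOn.inv₀ (by fun_prop) fun p hp h0 => hne _ hp.1 _ hp.2 (sub_eq_zero.1 h0)
    exact ((hfc.comp continuousOn_fst fun p hp => hp.1).mul h1).smul
      (hG.comp continuousOn_snd fun p hp => hp.2)

/-- The functional calculus is multiplicative. -/
theorem mul (hA : IsFunCalc T f A) (hB : IsFunCalc T g B) :
    IsFunCalc T (fun z => f z * g z) (A * B) := by
  obtain ⟨U, hU, hTU, hf, hg, h⟩ := hA.exists_common hB
  obtain ⟨Γ, hΓ⟩ := exists_surrounds (spectrum.isCompact T) hU hTU
  obtain ⟨Γ', hΓ', hΓΓ', hind⟩ := hΓ.exists_outer (spectrum.isCompact T) hU hTU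
  refine isFunCalc_of_surrounds (f := fun z => f z * g z) hU hTU (hf.mul hg) hΓ ?_
  have hR := hΓ.continuousOn_resolvent
  have hfc := hf.continuousOn.mono (hΓ.1.trans sdiff_subset)
  have hgc := hg.continuousOn.mono (hΓ.1.trans sdiff_subset)
  have hgc' := hg.continuousOn.mono (hΓ'.1.trans sdiff_subset)
  have hc : (2 * Real.pi * Complex.I : ℂ) ≠ 0 := Complex.two_pi_I_ne_zero
  have hinner : ∀ z ∈ Γ.trace,
      Γ'.integral (fun w => (f z * (w - z)⁻¹) • g w • resolvent T w) =
        (2 * Real.pi * Complex.I : ℂ) •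
          ((f z * g z) • resolvent T z - (f z • resolvent T z) * B) := by
    intro z hz
    simp only [mul_smul (f z)]
    rw [integral_const_smul, integral_resolvent_div hU hΓ hΓ' hΓΓ' hg hz, (h Γ' hΓ').2]
    generalize (2 * Real.pi * Complex.I : ℂ) = c
    rw [mul_smul_comm, smul_assoc, ← smul_sub, smul_comm (f z), smul_sub, smul_mul_assoc]
  -- The double integral of f(z) g(w) R(w) / (w - z) vanishes; the evaluation of its inner integral
  -- turns this into the product formula.
  have hzero := integral_integral_div_eq_zero (G := fun w => g w • resolvent T w) hU hΓ hΓΓ' hind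
    hf (hgc'.smul hΓ'.continuousOn_resolvent)
  have hB' : Γ.integral (fun z => (f z • resolvent T z) * B) =
      Γ.integral (fun z => f z • resolvent T z) * B :=
    integral_mul_const (f := fun z => f z • resolvent T z) (hfc.smul hR) B
  rw [integral_congr hinner, integral_const_smul, integral_sub (f := fun z => (f z * g z) • resolvent T z)
    (g := fun z => (f z • resolvent T z) * B) ((hfc.mul hgc).smul hR)
    ((hfc.smul hR).mul continuousOn_const), hB', (h Γ hΓ).1, smul_eq_zero, sub_eq_zero] at hzero
  rw [hzero.resolve_left hc, smul_mul_assoc, inv_smul_smul₀ hc]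

/-- From zR(z) = I + TR(z): the term with I contributes the integral of `f`, which is zero by
Cauchy's theorem. -/
theorem id_mul (hA : IsFunCalc T f A) : IsFunCalc T (fun z => z * f z) (T * A) := by
  obtain ⟨U, hU, hTU, hf, -, h⟩ := hA.exists_common hA
  obtain ⟨Γ, hΓ⟩ := exists_surrounds (spectrum.isCompact T) hU hTU
  refine isFunCalc_of_surrounds (f := fun z => z * f z) hU hTU (differentiableOn_id.mul hf) hΓ ?_
  have hR := hΓ.continuousOn_resolvent
  have hfc := hf.continuousOn.mono (hΓ.1.trans sdiff_subset)
  have e : ∀ z ∈ Γ.trace, (z * f z) • resolvent T z =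
      f z • (1 : X →L[ℂ] X) + T * (f z • resolvent T z) := fun z hz => by
    rw [mul_smul_comm, mul_resolvent (hΓ.1 hz).2, smul_sub, add_sub_cancel, mul_comm, mul_smul]
  have hT : Γ.integral (fun z => T * (f z • resolvent T z)) =
      T * Γ.integral fun z => f z • resolvent T z :=
    integral_const_mul (f := fun z => f z • resolvent T z) (hfc.smul hR) T
  rw [integral_congr e, integral_add (f := fun z => f z • (1 : X →L[ℂ] X))
    (g := fun z => T * (f z • resolvent T z)) (hfc.smul continuousOn_const)
    (continuousOn_const.mul (hfc.smul hR)), PlaneCycle.integral_smul_const hfc,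
    hΓ.integral_eq_zero hU hf, zero_smul, zero_add, hT, (h Γ hΓ).1, mul_smul_comm,
    inv_smul_smul₀ Complex.two_pi_I_ne_zero]

end IsFunCalc

theorem norm_edgeIntegral_le {E : Type*} [NormedAddCommGroup E] [NormedSpace ℂ E] {h M : ℝ}
    (hh : 0 ≤ h) (p : ℂ × Fin 4) {f : ℂ → E}
    (hf : ∀ t ∈ Icc (0 : ℝ) 1, ‖f (edge h p t)‖ ≤ M) : ‖edgeIntegral h p f‖ ≤ 2 * h * M := by
  have := intervalIntegral.norm_integral_le_of_norm_le_const (a := 0) (b := 1) (C := 2 * h * M)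
    (f := fun t => ((h : ℂ) * normal p.2 * (Complex.I * 2)) • f (edge h p t)) fun t ht => by
      rw [uIoc_of_le zero_le_one] at ht
      rw [norm_smul]
      have hn : ‖(h : ℂ) * normal p.2 * (Complex.I * 2)‖ = 2 * h := by
        simp [normal, abs_of_nonneg hh, mul_comm]
      rw [hn]
      exact mul_le_mul_of_nonneg_left (hf t (Ioc_subset_Icc_self ht)) (by positivity)
  simpa [edgeIntegral] using this

theorem le_norm_edge (h : ℝ) (d : Fin 4) (t : ℝ) : h ≤ ‖edge h (0, d) t‖ := by
  have e : edge h (0, d) t / normal d = h * (1 + Complex.I * (2 * t - 1)) := by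
    have := normal_ne_zero d
    simp only [edge, zero_add]
    field_simp
  have hn : ‖normal d‖ = 1 := by simp [normal]
  have h1 : ‖edge h (0, d) t / normal d‖ = ‖edge h (0, d) t‖ := by rw [norm_div, hn, div_one]
  rw [← h1, e]
  refine le_trans ?_ (Complex.re_le_norm _)
  rw [Complex.re_ofReal_mul]
  simp

/-- Over a large square centred at 0 the term 1/z contributes 2πi. The error R(z) - 1/z = z⁻¹ T R(z)
is o(1/|z|), while the perimeter grows only linearly. -/
theorem isFunCalc_one (T : X →L[ℂ] X) : IsFunCalc T (fun _ => 1) 1 := by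
  have hsurr : ∃ R : ℝ, 0 < R ∧ (∀ z ∈ spectrum ℂ T, ‖z‖ ≤ R) ∧
      ∀ h, R < h → (gridCycle h {0}).Surrounds (spectrum ℂ T) univ := by
    obtain ⟨R, hR⟩ := (spectrum.isCompact (𝕜 := ℂ) T).isBounded.exists_norm_le
    refine ⟨max R 1, by positivity, fun z hz => (hR z hz).trans (le_max_left _ _), fun h hh => ⟨fun z hz => ⟨mem_univ _, fun hzs => ?_⟩,
      fun z hz => index_gridCycle_singleton_of_abs_lt ?_ ?_, fun z hz => absurd (mem_univ z) hz⟩⟩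
    · obtain ⟨⟨c, d⟩, hp, -, t, -, rfl⟩ := mem_trace_gridCycle hz
      obtain rfl : c = 0 := Finset.mem_singleton.1 hp
      have := le_norm_edge h d t
      linarith [hR _ hzs, le_max_left R 1]
    · rw [sub_zero]
      linarith [Complex.abs_re_le_norm z, hR z hz, le_max_left R 1]
    · rw [sub_zero]
      linarith [Complex.abs_im_le_norm z, hR z hz, le_max_left R 1]
  obtain ⟨R, hR0, hTR, hR⟩ := hsurr
  have hsurr := hR (R + 1) (lt_add_one R)
  refine isFunCalc_of_surrounds isOpen_univ (subset_univ _) (differentiableOn_const 1) hsurr ?_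
  simp only [one_smul]
  set J := (gridCycle (R + 1) {0}).integral (resolvent T) -
    (2 * Real.pi * Complex.I : ℂ) • (1 : X →L[ℂ] X) with hJ
  have hJ0 : J = 0 := by
    rw [← norm_le_zero_iff]
    refine le_of_forall_pos_le_add fun ε hε => ?_
    rw [zero_add]
    have hlim := (spectrum.resolvent_tendsto_cobounded (𝕜 := ℂ) T).const_mul T
    rw [mul_zero] at hlim
    -- The perimeter `8 * h` times the bound `h⁻¹ * (ε / 8)` is exactly `ε`.
    have hev := hlim.norm.eventually (gt_mem_nhds (a := (ε / 8)) (by simpa using hε))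
    obtain ⟨ρ, -, hρ⟩ := (hasBasis_cobounded_norm (E := ℂ)).eventually_iff.1 hev
    obtain ⟨h, hh⟩ := exists_gt (max R ρ)
    have hRh : R < h := (le_max_left _ _).trans_lt hh
    have hρh : ρ < h := (le_max_right _ _).trans_lt hh
    have h0 : 0 < h := hR0.trans hRh
    have hΓ := hR h hRh
    have h0Γ : (0 : ℂ) ∉ (gridCycle h {0}).trace := fun hz => by
      obtain ⟨⟨c, d⟩, hp, -, t, -, hz⟩ := mem_trace_gridCycle hz
      obtain rfl : c = 0 := Finset.mem_singleton.1 hp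
      have := le_norm_edge h d t
      rw [← hz, norm_zero] at this
      linarith
    have hinv := continuousOn_sub_inv h0Γ
    have hind : (gridCycle h {0}).index 0 = 1 :=
      index_gridCycle_singleton_of_abs_lt (by simpa using h0) (by simpa using h0)
    have hJ' : J = (gridCycle h {0}).integral
        fun z => resolvent T z - (z - 0)⁻¹ • (1 : X →L[ℂ] X) := by
      rw [integral_sub (g := fun z => (z - 0)⁻¹ • (1 : X →L[ℂ] X)) hΓ.continuousOn_resolvent
        (hinv.smul continuousOn_const), PlaneCycle.integral_smul_const hinv, integral_sub_inv, hind,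
        mul_one, hJ, hsurr.integral_eq hΓ (spectrum.isClosed T) isOpen_univ
          ((differentiableOn_resolvent T).mono fun z hz => hz.2)]
    have hbd : ∀ d, ‖edgeIntegral h (0, d)
        fun z => resolvent T z - (z - 0)⁻¹ • (1 : X →L[ℂ] X)‖ ≤ 2 * h * (h⁻¹ * (ε / 8)) := by
      refine fun d => norm_edgeIntegral_le h0.le _ fun t ht => ?_
      have hz := le_norm_edge h d t
      have hsp : edge h (0, d) t ∉ spectrum ℂ T := fun hmem => by
        linarith [hTR _ hmem]
      set z := edge h (0, d) t
      have hz0 : z ≠ 0 := norm_pos_iff.1 (h0.trans_le hz)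
      have e : resolvent T z - (z - 0)⁻¹ • (1 : X →L[ℂ] X) = z⁻¹ • (T * resolvent T z) := by
        rw [mul_resolvent hsp, smul_sub, inv_smul_smul₀ hz0, sub_zero]
      rw [e, norm_smul, norm_inv]
      exact mul_le_mul (inv_anti₀ h0 hz) (hρ (hρh.le.trans hz)).le (norm_nonneg _)
        (inv_nonneg.2 h0.le)
    rw [hJ', integral_gridCycle, Finset.sum_singleton]
    refine (norm_sum_le_of_le _ fun d _ => hbd d).trans (le_of_eq ?_)
    simp only [Finset.sum_const, Finset.card_univ, Fintype.card_fin, nsmul_eq_mul]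
    field_simp
    norm_num
  rw [sub_eq_zero.1 (hJ.symm.trans hJ0), inv_smul_smul₀ Complex.two_pi_I_ne_zero]

end FunctionalCalculus

/-! ### Spectral mapping and spectral projections -/

section SpectralMapping

open PlaneCycle

variable {X : Type*} [NormedAddCommGroup X] [NormedSpace ℂ X] [CompleteSpace X] {T : X →L[ℂ] X}

theorem isFunCalc_id (T : X →L[ℂ] X) : IsFunCalc T (fun z => z) T := by
  simpa only [mul_one] using (isFunCalc_one T).id_mul

namespace IsFunCalc

variable {f g : ℂ → ℂ} {A B : X →L[ℂ] X}

theorem commute (hA : IsFunCalc T f A) (hB : IsFunCalc T g B) : Commute A B :=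
  (hA.mul hB).unique (hB.mul hA) (Eventually.of_forall fun _ => mul_comm _ _)

theorem const_sub (hA : IsFunCalc T f A) (c : ℂ) :
    IsFunCalc T (fun z => c - f z) (algebraMap ℂ _ c - A) := by
  have h := (isFunCalc_one T).linearComb hA c (-1)
  rw [neg_one_smul, ← sub_eq_add_neg, ← Algebra.algebraMap_eq_smul_one] at h
  simpa only [mul_one, neg_one_mul, ← sub_eq_add_neg] using h

/-- The reciprocal of `f` is holomorphic where `f` is nonzero, and multiplicativity makes its value
the inverse. -/
theorem isUnit (hA : IsFunCalc T f A) (hf0 : ∀ z ∈ spectrum ℂ T, f z ≠ 0) : IsUnit A := by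
  obtain ⟨U, hU, hTU, hf, -⟩ := id hA
  have hV : IsOpen (U ∩ f ⁻¹' {0}ᶜ) :=
    hf.continuousOn.isOpen_inter_preimage hU isOpen_compl_singleton
  have hTV : spectrum ℂ T ⊆ U ∩ f ⁻¹' {0}ᶜ := fun z hz => ⟨hTU hz, hf0 z hz⟩
  have hB := isFunCalc_holFunCalc (f := fun z => (f z)⁻¹) hV hTV
    ((hf.mono inter_subset_left).inv fun z hz => hz.2)
  have h1 := (hA.mul hB).unique (isFunCalc_one T) (eventually_nhdsSet_iff_exists.2
    ⟨_, hV, hTV, fun z hz => mul_inv_cancel₀ hz.2⟩)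
  exact ⟨⟨A, _, h1, (hA.commute hB).eq ▸ h1⟩, rfl⟩

/-- The spectral mapping theorem. -/
theorem spectrum_eq (hA : IsFunCalc T f A) : spectrum ℂ A = f '' spectrum ℂ T := by
  refine Subset.antisymm (fun μ hμ => ?_) ?_
  · by_contra hne
    exact hμ ((hA.const_sub μ).isUnit fun z hz h0 => hne ⟨z, hz, (sub_eq_zero.1 h0).symm⟩)
  · rintro _ ⟨l, hl, rfl⟩ hu
    obtain ⟨U, hU, hTU, hf, -⟩ := id hA
    -- The holomorphic quotient gives f(l) - f(z) = (l - z) q(z). Were f(l) - A invertible, its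
    -- commuting factor l - T would be too.
    have hB := isFunCalc_holFunCalc hU hTU
      ((Complex.differentiableOn_dslope (hU.mem_nhds (hTU hl))).2 hf)
    have hC := (isFunCalc_id T).const_sub l
    have h1 := (hC.mul hB).unique (hA.const_sub (f l)) (Eventually.of_forall fun z => by
      have := sub_smul_dslope f l z
      rw [smul_eq_mul] at this
      linear_combination -this)
    exact hl ((hC.commute hB).isUnit_mul_iff.1 (h1 ▸ hu)).1

end IsFunCalc

/-- The integral over contours around a spectral set is a value of the functional calculus. -/
theorem isFunCalc_indicator_of_isRieszIntegral {σ V₁ V₂ : Set ℂ} (hσ : IsSpectralSet T σ)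
    (hV₁ : IsOpen V₁) (hV₂ : IsOpen V₂) (hσ₁ : σ ⊆ V₁) (hσ₂ : spectrum ℂ T \ σ ⊆ V₂)
    (hV : Disjoint V₁ V₂) {P : X →L[ℂ] X}
    (hP : IsRieszIntegral T σ (spectrum ℂ T \ σ)ᶜ (fun _ => 1) P) :
    IsFunCalc T (V₁.indicator 1) P := by
  have hK := spectrum.isCompact (𝕜 := ℂ) T
  obtain ⟨Γ₁, h₁⟩ := exists_surrounds (hK.of_isClosed_subset hσ.2.1 hσ.1) hV₁ hσ₁
  obtain ⟨Γ₂, h₂⟩ := exists_surrounds (hK.of_isClosed_subset hσ.2.2 sdiff_subset) hV₂ hσ₂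
  have hd : DifferentiableOn ℂ (V₁.indicator (1 : ℂ → ℂ)) (V₁ ∪ V₂) := by
    rintro z (hz | hz)
    · exact (((differentiableAt_const (1 : ℂ)).congr_of_eventuallyEq
        (eventually_of_mem (hV₁.mem_nhds hz) fun w hw => indicator_of_mem hw _))
        ).differentiableWithinAt
    · exact (((differentiableAt_const (0 : ℂ)).congr_of_eventuallyEq
        (eventually_of_mem (hV₂.mem_nhds hz) fun w hw =>
          indicator_of_notMem (hV.notMem_of_mem_right hw) _))).differentiableWithinAt
  -- Together the two cycles surround the whole spectrum; the indicator then removes the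
  -- contribution of `Γ₂`.
  have hsurr : (Γ₁.append Γ₂).Surrounds (spectrum ℂ T) (V₁ ∪ V₂) := by
    refine ⟨?_, fun z hz => ?_, fun z hz => ?_⟩
    · rw [trace_append]
      refine union_subset (fun z hz => ⟨Or.inl (h₁.1 hz).1, fun hzT => ?_⟩)
        fun z hz => ⟨Or.inr (h₂.1 hz).1, fun hzT => ?_⟩
      · exact hV.notMem_of_mem_left (h₁.1 hz).1 (hσ₂ ⟨hzT, (h₁.1 hz).2⟩)
      · by_cases hzσ : z ∈ σ
        · exact hV.notMem_of_mem_right (h₂.1 hz).1 (hσ₁ hzσ)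
        · exact (h₂.1 hz).2 ⟨hzT, hzσ⟩
    · rw [index_append]
      by_cases hzσ : z ∈ σ
      · rw [h₁.2.1 z hzσ, h₂.2.2 z (hV.notMem_of_mem_left (hσ₁ hzσ)), add_zero]
      · rw [h₂.2.1 z ⟨hz, hzσ⟩, h₁.2.2 z (hV.notMem_of_mem_right (hσ₂ ⟨hz, hzσ⟩)), zero_add]
    · rw [index_append, h₁.2.2 z fun h => hz (Or.inl h), h₂.2.2 z fun h => hz (Or.inr h), add_zero]
  refine isFunCalc_of_surrounds (hV₁.union hV₂) (fun z hz => ?_) hd hsurr ?_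
  · by_cases hzσ : z ∈ σ
    exacts [Or.inl (hσ₁ hzσ), Or.inr (hσ₂ ⟨hz, hzσ⟩)]
  · have e₁ : ∀ z ∈ Γ₁.trace, V₁.indicator (1 : ℂ → ℂ) z • resolvent T z =
        (1 : ℂ) • resolvent T z := fun z hz => by
      rw [indicator_of_mem (h₁.1 hz).1, Pi.one_apply]
    have e₂ : ∀ z ∈ Γ₂.trace, V₁.indicator (1 : ℂ → ℂ) z • resolvent T z = 0 := fun z hz => by
      rw [indicator_of_notMem (hV.notMem_of_mem_right (h₂.1 hz).1), zero_smul]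
    have hsub : V₁ ⊆ (spectrum ℂ T \ σ)ᶜ := fun z hz hzs => hV.notMem_of_mem_left hz (hσ₂ hzs)
    rw [integral_append, integral_congr e₁, integral_congr e₂, ← hP.2 Γ₁ (h₁.mono hsub)]
    simp [PlaneCycle.integral]

theorem derivedSet_neg_image_subset {s : Set ℂ} (hs : derivedSet s ⊆ {0}) :
    derivedSet ((fun z => -z) '' s) ⊆ {0} := by
  intro x hx
  have h := AccPt.map hx (continuous_neg.continuousAt (x := x)) neg_injective
  rw [map_principal, image_image] at h
  simp only [neg_neg, image_id'] at h
  simpa using hs h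

end SpectralMapping

end

/-! ### The g_z-inverse associated to a spectral set -/

theorem mainTheorem6 {X : Type*} [NormedAddCommGroup X] [NormedSpace ℂ X] [CompleteSpace X]
    (T : X →L[ℂ] X) (hT : (0 : ℂ) ∈ spectrum ℂ T \ derivedSet (derivedSet (spectrum ℂ T)))
    (σ : Set ℂ) (hσ : IsSpectralSet T σ) (h0 : (0 : ℂ) ∈ σ)
    (hiso : σ \ {0} ⊆ isoPoints (spectrum ℂ T))
    (r : ℂ) (hr : ∀ z ∈ σ, ‖z‖ < ‖r‖) :
    -- the operator `T^D_σ = (T + r P_σ)⁻¹ (I - P_σ)` is well defined, and it is a `g_z`-inverse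
    IsRieszIntegral T σ (spectrum ℂ T \ σ)ᶜ (fun _ => 1) (spectralProjection T σ) ∧
    IsUnit (T + r • spectralProjection T σ) ∧
    IsGzInverse T (spectralGzInverse T σ r) ∧
    -- functions `f_σ` exist, and for each of them `f_σ(T)` is well defined and equal to `T^D_σ`
    (∃ (U : Set ℂ) (f : ℂ → ℂ), IsReciprocalOff T σ U f) ∧
    (∀ (U : Set ℂ) (f : ℂ → ℂ), IsReciprocalOff T σ U f →
      IsRieszIntegral T (spectrum ℂ T) U f (holFunCalc T U f) ∧
      spectralGzInverse T σ r = holFunCalc T U f) ∧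
    -- the spectrum of `T^D_σ`
    spectrum ℂ (spectralGzInverse T σ r) =
      {0} ∪ {w : ℂ | ∃ z ∈ spectrum ℂ T \ σ, w = z⁻¹} := by
  have hK := spectrum.isCompact (𝕜 := ℂ) T
  have hKσ := hK.of_isClosed_subset hσ.2.1 hσ.1
  obtain ⟨V₁, V₂, hV₁, hV₂, hσ₁, hσ₂', hV⟩ := SeparatedNhds.of_isCompact_isCompact hKσ
    (hK.of_isClosed_subset hσ.2.2 sdiff_subset) disjoint_sdiff_self_right
  have hP : IsRieszIntegral T σ (spectrum ℂ T \ σ)ᶜ (fun _ => 1) (spectralProjection T σ) :=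
    isRieszIntegral_rieszIntegral hKσ hσ.2.2.isOpen_compl (fun z hz hz' => hz'.2 hz)
      (fun z hz => by_contra fun hzσ => hz.1 ⟨hz.2, hzσ⟩) (differentiableOn_const 1)
  have hPχ := isFunCalc_indicator_of_isRieszIntegral hσ hV₁ hV₂ hσ₁ hσ₂' hV hP
  set P := spectralProjection T σ
  set χ : ℂ → ℂ := V₁.indicator 1 with hχ
  have hχ₁ : ∀ z ∈ V₁, χ z = 1 := fun z hz => indicator_of_mem hz _
  have hχ₂ : ∀ z ∈ V₂, χ z = 0 := fun z hz => indicator_of_notMem (hV.notMem_of_mem_right hz) _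
  have hcases : ∀ {z}, z ∈ spectrum ℂ T → z ∈ σ ∨ z ∈ spectrum ℂ T \ σ := fun {z} hz =>
    (em (z ∈ σ)).imp_right fun h => ⟨hz, h⟩
  have hTP : IsFunCalc T (fun z => z + r * χ z) (T + r • P) := by
    simpa only [one_mul, one_smul] using (isFunCalc_id T).linearComb hPχ 1 r
  have hunit : IsUnit (T + r • P) := hTP.isUnit fun z hz hz0 => by
    rcases hcases hz with hzσ | hzσ
    · rw [hχ₁ z (hσ₁ hzσ), mul_one] at hz0
      have := hr z hzσ
      rw [eq_neg_of_add_eq_zero_left hz0, norm_neg] at this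
      exact lt_irrefl _ this
    · rw [hχ₂ z (hσ₂' hzσ), mul_zero, add_zero] at hz0
      exact hzσ.2 (hz0 ▸ h0)
  have h1P : IsFunCalc T (fun z => 1 - χ z) (1 - P) := by
    simpa only [map_one] using hPχ.const_sub 1
  have hspec : ∀ {p : ℂ → Prop}, (∀ᶠ z in 𝓝ˢ σ, p z) → (∀ᶠ z in 𝓝ˢ (spectrum ℂ T \ σ), p z) →
      ∀ᶠ z in 𝓝ˢ (spectrum ℂ T), p z := fun h₁ h₂ => by
    rw [← union_sdiff_cancel hσ.1, nhdsSet_union]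
    exact eventually_sup.2 ⟨h₁, h₂⟩
  have hev₁ : ∀ᶠ z in 𝓝ˢ σ, z ∈ V₁ := hV₁.mem_nhdsSet.2 hσ₁
  have hev₂ : ∀ᶠ z in 𝓝ˢ (spectrum ℂ T \ σ), z ∈ V₂ ∧ z ≠ 0 :=
    (hV₂.inter isOpen_compl_singleton).mem_nhdsSet.2
      fun z hz => ⟨hσ₂' hz, fun hz0 => hz.2 ((mem_singleton_iff.1 hz0) ▸ h0)⟩
  have hS : ∀ (U : Set ℂ) (f : ℂ → ℂ), IsReciprocalOff T σ U f →
      IsFunCalc T f (spectralGzInverse T σ r) ∧ spectralGzInverse T σ r = holFunCalc T U f := by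
    rintro U f ⟨hU, hTU, hf, hf₁, hf₂⟩
    have hfc := isFunCalc_holFunCalc hU hTU hf
    -- Near σ both sides are 0; near the rest both are 1. Multiplying by the inverse of T + rP_σ
    -- then gives T^D_σ.
    have h1 := (hTP.mul hfc).unique h1P (hspec
      ((hf₁.and hev₁).mono fun z hz => by rw [hz.1, hχ₁ z hz.2]; ring)
      ((hf₂.and hev₂).mono fun z hz => by
        rw [hz.1, hχ₂ z hz.2.1, mul_zero, add_zero, mul_one_div_cancel hz.2.2, sub_zero]))
    have h2 : spectralGzInverse T σ r = holFunCalc T U f := by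
      rw [spectralGzInverse, ← h1, ← mul_assoc, Ring.inverse_mul_cancel _ hunit, one_mul]
    exact ⟨h2 ▸ hfc, h2⟩
  have hex : ∃ (U : Set ℂ) (f : ℂ → ℂ), IsReciprocalOff T σ U f := by
    -- On `V₁` the factor `1 - χ z` vanishes, so the value of `1 / z` at 0 is harmless.
    refine ⟨V₁ ∪ V₂ ∩ {0}ᶜ, fun z => (1 - χ z) * (1 / z),
      hV₁.union (hV₂.inter isOpen_compl_singleton), ?_, ?_, ?_, ?_⟩
    · intro z hz
      rcases hcases hz with hzσ | hzσ
      · exact Or.inl (hσ₁ hzσ)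
      · exact Or.inr ⟨hσ₂' hzσ, fun hz0 => hzσ.2 ((mem_singleton_iff.1 hz0) ▸ h0)⟩
    · rintro z (hz | hz)
      · refine ((differentiableAt_const (0 : ℂ)).congr_of_eventuallyEq
          (eventually_of_mem (hV₁.mem_nhds hz) fun w hw => ?_)).differentiableWithinAt
        simp [hχ₁ w hw]
      · have : DifferentiableAt ℂ (fun z : ℂ => 1 / z) z :=
          (differentiableAt_const (1 : ℂ)).div differentiableAt_id hz.2
        refine (this.congr_of_eventuallyEq
          (eventually_of_mem (hV₂.mem_nhds hz.1) fun w hw => ?_)).differentiableWithinAt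
        simp [hχ₂ w hw]
    · exact hev₁.mono fun z hz => by simp [hχ₁ z hz]
    · exact hev₂.mono fun z hz => by simp [hχ₂ z hz.1]
  obtain ⟨U, f, hUf⟩ := id hex
  obtain ⟨-, -, -, hf₁, hf₂⟩ := id hUf
  have hSf := (hS U f hUf).1
  set S := spectralGzInverse T σ r
  have hTid := isFunCalc_id T
  have hfσ : ∀ z ∈ σ, f z = 0 := fun z hz => hf₁.self_of_nhdsSet z hz
  have hfσ' : ∀ z ∈ spectrum ℂ T \ σ, f z = 1 / z := fun z hz => hf₂.self_of_nhdsSet z hz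
  have hne : ∀ z ∈ spectrum ℂ T \ σ, z ≠ 0 := fun z hz hz0 => hz.2 (hz0 ▸ h0)
  refine ⟨hP, hunit, ⟨?_, hTid.commute hSf, ?_, ?_⟩, hex, fun U f hUf =>
    ⟨isRieszIntegral_holFunCalc hUf.1 hUf.2.1 hUf.2.2.1, (hS U f hUf).2⟩, ?_⟩
  · have hB := hTid.mul h1P
    have hBS := hB.commute hSf
    have hSBS : S * (T * (1 - P)) * S = S :=
      ((hSf.mul hB).mul hSf).unique hSf (hspec (hf₁.mono fun z hz => by simp [hz])
        ((hf₂.and hev₂).mono fun z hz => by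
          have := hz.2.2
          rw [hz.1, hχ₂ z hz.2.1]; field_simp; ring))
    -- Exponent 1 suffices: the function z(1 - χ(z)) inverts f off σ, and both vanish on σ.
    refine ⟨T * (1 - P), hBS, ?_, 1, by rw [pow_one, hSBS]⟩
    exact ((hB.mul hSf).mul hB).unique hB (hspec
      ((hf₁.and hev₁).mono fun z hz => by simp [hχ₁ z hz.2])
      ((hf₂.and hev₂).mono fun z hz => by
          have := hz.2.2
          rw [hz.1, hχ₂ z hz.2.1]; field_simp; ring))
  · exact ((hSf.mul hTid).mul hSf).unique hSf (hspec (hf₁.mono fun z hz => by simp [hz])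
      ((hf₂.and hev₂).mono fun z hz => by
        have := hz.2.2
        rw [hz.1]; field_simp))
  · have hZ : IsFunCalc T (fun z => z * z * f z - z) (T ^ 2 * S - T) := by
      have := ((hTid.mul hTid).mul hSf).linearComb hTid 1 (-1)
      rw [one_smul, neg_one_smul, ← sub_eq_add_neg, ← pow_two] at this
      simpa only [one_mul, neg_one_mul, ← sub_eq_add_neg] using this
    -- A nonzero accumulation point of the closed set σ would lie in σ and so be isolated in the
    -- spectrum.
    have hσd : derivedSet σ ⊆ {0} := fun x hx => by
      by_contra hx0
      exact (hiso ⟨(isClosed_iff_derivedSet_subset σ).1 hσ.2.1 hx, hx0⟩).2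
        (derivedSet_mono _ _ hσ.1 hx)
    rw [IsZeroloid, hZ.spectrum_eq]
    refine (derivedSet_mono _ _ ?_).trans (derivedSet_neg_image_subset hσd)
    rintro _ ⟨z, hz, rfl⟩
    rcases hcases hz with hzσ | hzσ
    · exact ⟨z, hzσ, by simp [hfσ z hzσ]⟩
    -- Off σ the function takes the value 0, which is the negative of the point 0 of σ.
    · refine ⟨0, h0, ?_⟩
      have := hne z hzσ
      simp only [hfσ' z hzσ]
      field_simp
      ring
  · rw [hSf.spectrum_eq]
    ext w
    constructor
    · rintro ⟨z, hz, rfl⟩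
      rcases hcases hz with hzσ | hzσ
      · exact Or.inl (hfσ z hzσ)
      · exact Or.inr ⟨z, hzσ, by rw [hfσ' z hzσ, one_div]⟩
    · rintro (rfl | ⟨z, hz, rfl⟩)
      · exact ⟨0, hT.1, hfσ 0 h0⟩
      · exact ⟨z, hz.1, by rw [hfσ' z hz, one_div]⟩
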